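/- Let $(E,\mathcal E,\pi)$ be a probability space with $\{(x,x):x\in E\}\in\mathcal E\times\mathcal E$, and let $J$ be a non-negative symmetric measure on $E\times E$ that does not charge the diagonal. For $f\in L^2(\pi)$ put $$D(f)=\tfrac12\int_{E\times E}(f(y)-f(x))^2\,J(dx,dy)\in[0,\infty].$$ Let $r:E\times E\to[0,\infty)$ be measurable and symmetric, put $J^{(\alpha)}(dx,dy)=1_{\{r(x,y)>0\}}\,r(x,y)^{-\alpha}J(dx,dy)$ for $\alpha>0$, and assume that $J^{(1)}(dx,E)/\pi(dx)\le 1$ $\pi$-a.s., i.e. $J^{(1)}(A\times E)\le\pi(A)$ for all $A\in\mathcal E$. Write $K=J^{(1/2)}$, $\mathrm{Var}(f)=\pi(f^2)-\pi(f)^2$, $\|f\|_s$ for the norm of $L^s(\pi)$ and $\|f\|=\|f\|_2$. Below $A$ runs over $\mathcal E$, $a\wedge b=\min(a,b)$, and $\inf\emptyset=\infty$. **Theorem.** 1. (Poincaré) If $$\inf_{\pi(A)\in(0,1)}\frac{K(A\times A^c)}{\pi(A)\wedge\pi(A^c)}>0,$$ then there is a constant $C<\infty$ with $\mathrm{Var}(f)\le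 C\,D(f)$ for all $f\in L^2(\pi)$. 2. (Nash) Let $p,q>1$ with $1/p+1/q=1$ and $\nu=2(q-1)$. If $$\inf_{\pi(A)\in(0,1)}\frac{K(A\times A^c)}{[\pi(A)\wedge\pi(A^c)]^{(\nu-1)/\nu}}>0,$$ then there is a constant $C<\infty$ with $\mathrm{Var}(f)\le C\,D(f)^{1/p}\|f\|_1^{2/q}$ for all $f\in L^2(\pi)$. 3. (Logarithmic Sobolev) Suppose that the form is irreducible: $J(A\times A^c)>0$ whenever $\pi(A)\in(0,1)$. If $$\lim_{s\to0+}\ \inf_{\pi(A)\in(0,s]}\frac{K(A\times A^c)}{\pi(A)\sqrt{\log[e+\pi(A)^{-1}]}}>0,$$ or if $$\lim_{\delta\to\infty}\ \inf_{\pi(A)>0}\frac{K(A\times A^c)+\delta\,\pi(A)}{\pi(A)\sqrt{1-\log\pi(A)}}>0,$$ then there is a constant $C<\infty$ with $$\int f^2\log\big(f^2/\|f\|^2\big)\,d\pi\le C\,D(f)\qquad\text{for all } f\in L^2(\pi);$$ in particular, the integral is finite whenever $D(f)<\infty$. -/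

import Mathlib

open MeasureTheory ProbabilityTheory Filter Topology
open scoped ENNReal NNReal

namespace JumpForm

variable {E : Type*} [MeasurableSpace E]

/-- The value `D(f) = ½ ∫ (f(y) - f(x))² J(dx, dy)`, in `[0, ∞]`, of the symmetric form of `J`. -/
noncomputable def energy (J : Measure (E × E)) (f : E → ℝ) : ℝ≥0∞ :=
  2⁻¹ * ∫⁻ z, ENNReal.ofReal ((f z.2 - f z.1) ^ 2) ∂J

/-- The measure `J^{(α)}(dx, dy) = 1_{r(x, y) > 0} J(dx, dy) / r(x, y)^α`. -/
noncomputable def modified (J : Measure (E × E)) (r : E × E → ℝ≥0) (α : ℝ) : Measure (E × E) :=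
  (J.restrict {z | 0 < r z}).withDensity fun z => ((r z : ℝ≥0∞) ^ α)⁻¹

/-- The form of `J` is irreducible with respect to `π`: there is no splitting of the space in two
sets of positive `π`-measure between which `J` has no mass. -/
def Irreducible (π : Measure E) (J : Measure (E × E)) : Prop :=
  ∀ A : Set E, MeasurableSet A → 0 < π A → π A < 1 → 0 < J (A ×ˢ Aᶜ)

/-! Cheeger type constants, of `K = J^{(α)}`; the infimum over the empty set is `∞`. -/

/-- `inf_{π(A) ∈ (0,1)} K(A × Aᶜ) / (π(A) ∧ π(Aᶜ))`. -/
noncomputable def poincareConst (π : Measure E) (K : Measure (E × E)) : ℝ≥0∞ :=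
  ⨅ (A : Set E) (_ : MeasurableSet A) (_ : 0 < π A) (_ : π A < 1),
    K (A ×ˢ Aᶜ) / min (π A) (π Aᶜ)

/-- `inf_{π(A) ∈ (0,1)} K(A × Aᶜ) / (π(A) ∧ π(Aᶜ))^{(ν-1)/ν}`. -/
noncomputable def nashConst (π : Measure E) (K : Measure (E × E)) (ν : ℝ) : ℝ≥0∞ :=
  ⨅ (A : Set E) (_ : MeasurableSet A) (_ : 0 < π A) (_ : π A < 1),
    K (A ×ˢ Aᶜ) / (min (π A) (π Aᶜ)) ^ ((ν - 1) / ν)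

/-- `inf_{π(A) ∈ (0,s]} K(A × Aᶜ) / (π(A) √(log(e + π(A)⁻¹)))`. -/
noncomputable def logSobolevInfSmall (π : Measure E) (K : Measure (E × E)) (s : ℝ) : ℝ≥0∞ :=
  ⨅ (A : Set E) (_ : MeasurableSet A) (_ : 0 < π A) (_ : π A ≤ ENNReal.ofReal s),
    K (A ×ˢ Aᶜ) /
      ENNReal.ofReal (π.real A * √(Real.log (Real.exp 1 + (π.real A)⁻¹)))

/-- First logarithmic Sobolev constant: the limit, as `s → 0+`, of
`inf_{π(A) ∈ (0,s]} K(A × Aᶜ) / (π(A) √(log(e + π(A)⁻¹)))`. -/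
noncomputable def logSobolevConstSmall (π : Measure E) (K : Measure (E × E)) : ℝ≥0∞ :=
  limUnder (𝓝[>] (0 : ℝ)) (logSobolevInfSmall π K)

/-- `inf_{π(A) > 0} (K(A × Aᶜ) + δ π(A)) / (π(A) √(1 - log π(A)))`. -/
noncomputable def logSobolevInfShift (π : Measure E) (K : Measure (E × E)) (δ : ℝ) : ℝ≥0∞ :=
  ⨅ (A : Set E) (_ : MeasurableSet A) (_ : 0 < π A),
    (K (A ×ˢ Aᶜ) + ENNReal.ofReal δ * π A) /
      ENNReal.ofReal (π.real A * √(1 - Real.log (π.real A)))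

/-- Second logarithmic Sobolev constant: the limit, as `δ → ∞`, of
`inf_{π(A) > 0} (K(A × Aᶜ) + δ π(A)) / (π(A) √(1 - log π(A)))`. -/
noncomputable def logSobolevConstShift (π : Measure E) (K : Measure (E × E)) : ℝ≥0∞ :=
  limUnder atTop (logSobolevInfShift π K)

/-- The limit in `logSobolevConstSmall` exists. -/
theorem tendsto_logSobolevInfSmall (π : Measure E) (K : Measure (E × E)) :
    Tendsto (logSobolevInfSmall π K) (𝓝[>] (0 : ℝ)) (𝓝 (logSobolevConstSmall π K)) := by
  refine tendsto_nhds_limUnder ?_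
  have h : Antitone (logSobolevInfSmall π K) := by
    intro s t hst
    refine le_iInf fun A => le_iInf fun hA => le_iInf fun h0 => le_iInf fun h1 => ?_
    exact iInf_le_of_le A (iInf_le_of_le hA (iInf_le_of_le h0
      (iInf_le_of_le (h1.trans (ENNReal.ofReal_le_ofReal hst)) le_rfl)))
  exact ⟨_, h.dual_right.tendsto_nhdsGT 0⟩

/-- The limit in `logSobolevConstShift` exists. -/
theorem tendsto_logSobolevInfShift (π : Measure E) (K : Measure (E × E)) :
    Tendsto (logSobolevInfShift π K) atTop (𝓝 (logSobolevConstShift π K)) := by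
  refine tendsto_nhds_limUnder ⟨_, tendsto_atTop_iSup ?_⟩
  intro s t hst
  unfold logSobolevInfShift
  gcongr

/-! The inequalities. `f` runs over the measurable functions in `L²(π)`. -/

/-- Poincaré inequality: `Var(f) ≤ C D(f)` for all `f ∈ L²(π)`. -/
def PoincareInequality (π : Measure E) (J : Measure (E × E)) : Prop :=
  ∃ C : ℝ, 0 < C ∧ ∀ f : E → ℝ, Measurable f → MemLp f 2 π →
    ENNReal.ofReal (variance f π) ≤ ENNReal.ofReal C * energy J f

/-- Nash inequality: `Var(f) ≤ C D(f)^{1/p} ‖f‖₁^{2/q}` for all `f ∈ L²(π)`. -/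
def NashInequality (π : Measure E) (J : Measure (E × E)) (p q : ℝ) : Prop :=
  ∃ C : ℝ, 0 < C ∧ ∀ f : E → ℝ, Measurable f → MemLp f 2 π →
    ENNReal.ofReal (variance f π) ≤
      ENNReal.ofReal C * energy J f ^ (1 / p) * eLpNorm f 1 π ^ (2 / q)

/-- Logarithmic Sobolev inequality: `∫ f² log(f² / ‖f‖²) dπ ≤ C D(f)` for all `f ∈ L²(π)`.
It is void where `D(f) = ∞`; where `D(f) < ∞` the integral is asserted to be finite. -/
def LogSobolevInequality (π : Measure E) (J : Measure (E × E)) : Prop :=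
  ∃ C : ℝ, 0 < C ∧ ∀ f : E → ℝ, Measurable f → MemLp f 2 π → energy J f < ∞ →
    Integrable (fun x => f x ^ 2 * Real.log (f x ^ 2 / ∫ y, f y ^ 2 ∂π)) π ∧
    ∫ x, f x ^ 2 * Real.log (f x ^ 2 / ∫ y, f y ^ 2 ∂π) ∂π ≤ C * (energy J f).toReal

end JumpForm

namespace JumpForm

variable {E : Type*} [MeasurableSpace E]

/-! ### Energy and elementary contractions -/

/-! The engine is Cheeger's method. Cauchy-Schwarz, with the weight of `K = r^{-1/2} J` put on one
factor, and the normalization of `J^{(1)}` give `(∫ (g(x) - g(y))₊ v(x) dK)² ≤ 2 D(g) π(v²)`. For `v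
= w ∘ g` with `w` monotone, the integral on the left dominates `∫ w(t) K({g > t} × {g ≤ t}) dt`. An
isoperimetric bound `K(A × Aᶜ) ≥ κ(t) π(A)` for `A = {g > t}` turns this into an integral of `g`, up
to halving the argument. This is `sq_lintegral_le_of_isoperimetric`; each inequality is a choice of
`w` and `κ`.

Poincaré: `w(t) = t` and `κ` constant. Nash: Markov's inequality turns the exponent `1 - 1/ν` into
`κ(t) = k (t/n)^{1/ν}`, so the energy controls a moment above the second, and L² is interpolated. In
both cases `f` is cut at a median, so that all relevant level sets have measure at most 1/2.

Logarithmic Sobolev: either constant yields an isoperimetric inequality for small sets only. For a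
normalized `h`, Chebyshev gives `π(h > t) ≤ t⁻²`, and `w(t) = t √(log t)`, `κ(t) = k √(log t)` above
a high level give a defective inequality. Removing the defect needs a Poincaré inequality, which
comes from irreducibility (`Irreducible.poincareInequality`). Small sets satisfy a Faber-Krahn
inequality. If Poincaré failed, there would be `[0, 1]`-valued functions of arbitrarily small
energy, with integral bounded below and a cutoff of integral at most 1/2. Irreducibility makes
functions of small energy nearly uncorrelated with any fixed bounded one, so products of finitely
many of them have small support, integral bounded below and still arbitrarily small energy, against
Faber-Krahn. Finally the entropy of `f` is estimated through `f - π(f)` by a pointwise bound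
(`sq_mul_log_sub_le`). -/

theorem measurable_ofReal_sq_sub {f : E → ℝ} (hf : Measurable f) :
    Measurable fun z : E × E => ENNReal.ofReal ((f z.2 - f z.1) ^ 2) := by
  fun_prop

theorem energy_le_of_forall (J : Measure (E × E)) {f g : E → ℝ} {C : ℝ} (hC : 0 ≤ C)
    (h : ∀ x y, (f y - f x) ^ 2 ≤ C * (g y - g x) ^ 2) :
    energy J f ≤ ENNReal.ofReal C * energy J g := by
  unfold energy
  rw [mul_left_comm, ← lintegral_const_mul' _ _ ENNReal.ofReal_ne_top]
  gcongr with z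
  rw [← ENNReal.ofReal_mul hC]
  exact ENNReal.ofReal_le_ofReal (h _ _)

theorem energy_mono_of_forall (J : Measure (E × E)) {f g : E → ℝ}
    (h : ∀ x y, (f y - f x) ^ 2 ≤ (g y - g x) ^ 2) : energy J f ≤ energy J g := by
  simpa using energy_le_of_forall J zero_le_one (f := f) (g := g) (by simpa using h)

theorem energy_le_add_of_forall (J : Measure (E × E)) {f g h : E → ℝ} (hg : Measurable g)
    {C C' : ℝ} (hC : 0 ≤ C) (hC' : 0 ≤ C')
    (H : ∀ x y, (f y - f x) ^ 2 ≤ C * (g y - g x) ^ 2 + C' * (h y - h x) ^ 2) :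
    energy J f ≤ ENNReal.ofReal C * energy J g + ENNReal.ofReal C' * energy J h := by
  unfold energy
  rw [mul_left_comm, mul_left_comm (ENNReal.ofReal C'), ← lintegral_const_mul' _ _
    ENNReal.ofReal_ne_top, ← lintegral_const_mul' _ _ ENNReal.ofReal_ne_top, ← mul_add,
    ← lintegral_add_left ((measurable_ofReal_sq_sub hg).const_mul _)]
  gcongr with z
  rw [← ENNReal.ofReal_mul hC, ← ENNReal.ofReal_mul hC', ← ENNReal.ofReal_add (by positivity)
    (by positivity)]
  exact ENNReal.ofReal_le_ofReal (H _ _)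

/-! ### The modified measures -/

section Modified

variable {π : Measure E} {J : Measure (E × E)} {r : E × E → ℝ≥0}

/-- `J` may fail to be s-finite, but on `{r > 0}` it has the finite density `r` with respect to the
finite measure `J^{(1)}`. Tonelli's theorem in the coarea estimate needs this. -/
theorem sFinite_restrict_of_fst_le [IsFiniteMeasure π] (hr : Measurable r)
    (hnorm : (modified J r 1).fst ≤ π) :
    SFinite (J.restrict {z | 0 < r z}) := by
  have hfin : IsFiniteMeasure (modified J r 1) := by
    refine ⟨?_⟩
    rw [← Measure.fst_univ]
    exact (hnorm _).trans_lt (measure_lt_top _ _)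
  have hs : MeasurableSet {z | 0 < r z} := measurableSet_lt measurable_const hr
  have h := withDensity_inv_same (μ := J.restrict {z | 0 < r z})
    (f := fun z => ((r z : ℝ≥0∞) ^ (1 : ℝ))⁻¹) (by fun_prop) ?_ ?_
  · rw [← h]
    change SFinite ((modified J r 1).withDensity _)
    infer_instance
  · exact ae_of_all _ fun z => by simp
  · filter_upwards [ae_restrict_mem hs] with z hz
    simpa using (ne_of_gt hz)

theorem sFinite_modified [IsFiniteMeasure π] (hr : Measurable r)
    (hnorm : (modified J r 1).fst ≤ π) (α : ℝ) :
    SFinite (modified J r α) := by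
  have := sFinite_restrict_of_fst_le hr hnorm
  unfold modified
  infer_instance

theorem lintegral_modified (hr : Measurable r) (α : ℝ) {F : E × E → ℝ≥0∞} (hF : Measurable F) :
    ∫⁻ z, F z ∂(modified J r α) =
      ∫⁻ z in {z | 0 < r z}, ((r z : ℝ≥0∞) ^ α)⁻¹ * F z ∂J := by
  unfold modified
  rw [lintegral_withDensity_eq_lintegral_mul _ (by fun_prop) hF]
  rfl

/-- The Cauchy-Schwarz inequality between the form, its modification and the normalization. -/
theorem lintegral_modified_half_le (hr : Measurable r) (hnorm : (modified J r 1).fst ≤ π)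
    {g : E → ℝ} (hg : Measurable g) {v : E → ℝ≥0∞} (hv : Measurable v) :
    (∫⁻ z, ENNReal.ofReal (g z.1 - g z.2) * v z.1 ∂(modified J r (1 / 2))) ^ 2 ≤
      2 * energy J g * ∫⁻ x, v x ^ 2 ∂π := by
  rw [lintegral_modified hr _ (by fun_prop)]
  -- The whole weight `r^{-1/2}` goes with `v`: squared, it produces `J^{(1)}`, while the increments
  -- of `g` are integrated against `J` itself.
  have h1 : ∀ z : E × E, ((r z : ℝ≥0∞) ^ (1 / 2 : ℝ))⁻¹ *
      (ENNReal.ofReal (g z.1 - g z.2) * v z.1) =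
      ((fun z : E × E => ENNReal.ofReal (g z.1 - g z.2)) *
        fun z => ((r z : ℝ≥0∞) ^ (1 / 2 : ℝ))⁻¹ * v z.1) z := by
    intro z
    simp only [Pi.mul_apply]
    ring
  simp_rw [h1]
  have hcs := ENNReal.lintegral_mul_le_Lp_mul_Lq (J.restrict {z | 0 < r z})
    Real.HolderConjugate.two_two (f := fun z : E × E => ENNReal.ofReal (g z.1 - g z.2))
    (g := fun z => ((r z : ℝ≥0∞) ^ (1 / 2 : ℝ))⁻¹ * v z.1) (by fun_prop) (by fun_prop)
  have hsq : ∀ a : ℝ≥0∞, (a ^ (1 / 2 : ℝ)) ^ 2 = a := by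
    intro a
    rw [← ENNReal.rpow_natCast, ← ENNReal.rpow_mul]
    norm_num
  refine (pow_le_pow_left' hcs 2).trans ?_
  rw [mul_pow, hsq, hsq]
  gcongr
  · unfold energy
    rw [← mul_assoc, ENNReal.mul_inv_cancel (by simp) (by simp), one_mul]
    refine (lintegral_mono fun z => ?_).trans (setLIntegral_le_lintegral {z | 0 < r z} _)
    simp only [ENNReal.rpow_ofNat]
    rcases le_total (g z.1) (g z.2) with h | h
    · rw [ENNReal.ofReal_of_nonpos (by linarith)]
      simp
    · rw [← ENNReal.ofReal_pow (by linarith)]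
      exact ENNReal.ofReal_le_ofReal (by nlinarith)
  · calc ∫⁻ z in {z | 0 < r z}, (((r z : ℝ≥0∞) ^ (1 / 2 : ℝ))⁻¹ * v z.1) ^ (2 : ℝ) ∂J
        = ∫⁻ z in {z | 0 < r z}, ((r z : ℝ≥0∞) ^ (1 : ℝ))⁻¹ * v z.1 ^ 2 ∂J := by
          refine lintegral_congr fun z => ?_
          simp only [ENNReal.rpow_ofNat]
          rw [mul_pow, ← ENNReal.inv_pow, hsq, ENNReal.rpow_one]
      _ = ∫⁻ z, v z.1 ^ 2 ∂(modified J r 1) := (lintegral_modified hr 1 (by fun_prop)).symm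
      _ = ∫⁻ x, v x ^ 2 ∂(modified J r 1).fst := by
          rw [Measure.fst, lintegral_map (by fun_prop) measurable_fst]
      _ ≤ ∫⁻ x, v x ^ 2 ∂π := lintegral_mono' hnorm le_rfl

/-- The coarea estimate: the boundary measures of the level sets of `g`, integrated against a
monotone weight, are controlled by the energy of `g`. -/
theorem sq_lintegral_boundary_le [IsFiniteMeasure π] (hr : Measurable r)
    (hnorm : (modified J r 1).fst ≤ π)
    {g : E → ℝ} (hg : Measurable g) {w : ℝ → ℝ≥0∞} (hw : Monotone w) :
    (∫⁻ t, w t * modified J r (1 / 2) ({x | t < g x} ×ˢ {x | t < g x}ᶜ)) ^ 2 ≤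
      2 * energy J g * ∫⁻ x, w (g x) ^ 2 ∂π := by
  have := sFinite_modified hr hnorm (1 / 2)
  have hwm := hw.measurable
  refine le_trans (pow_le_pow_left' ?_ 2)
    (lintegral_modified_half_le hr hnorm hg (v := fun x => w (g x)) (by fun_prop))
  set K := modified J r (1 / 2)
  have hset : MeasurableSet {p : ℝ × (E × E) | p.1 < g p.2.1 ∧ g p.2.2 ≤ p.1} :=
    (measurableSet_lt measurable_fst (by fun_prop)).inter
      (measurableSet_le (by fun_prop) measurable_fst)
  calc ∫⁻ t, w t * K ({x | t < g x} ×ˢ {x | t < g x}ᶜ)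
      = ∫⁻ t, ∫⁻ z, {p : ℝ × (E × E) | p.1 < g p.2.1 ∧ g p.2.2 ≤ p.1}.indicator
          (fun p => w p.1) (t, z) ∂K := by
        refine lintegral_congr fun t => ?_
        have ht : MeasurableSet ({x | t < g x} ×ˢ {x | t < g x}ᶜ) :=
          (measurableSet_lt measurable_const hg).prod (measurableSet_lt measurable_const hg).compl
        rw [← lintegral_indicator_const ht]
        refine lintegral_congr fun z => ?_
        simp [Set.indicator_apply]
    _ = ∫⁻ z, (∫⁻ t : ℝ, {p : ℝ × (E × E) | p.1 < g p.2.1 ∧ g p.2.2 ≤ p.1}.indicator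
          (fun p => w p.1) (t, z)) ∂K := by
        refine lintegral_lintegral_swap (μ := volume) (ν := K)
          (f := fun t z => {p : ℝ × (E × E) | p.1 < g p.2.1 ∧ g p.2.2 ≤ p.1}.indicator
            (fun p => w p.1) (t, z)) ?_
        exact (Measurable.indicator (by fun_prop) hset).aemeasurable
    _ ≤ ∫⁻ z, ENNReal.ofReal (g z.1 - g z.2) * w (g z.1) ∂K := by
        refine lintegral_mono fun z => ?_
        -- The pair is separated exactly by the levels in `[g z.2, g z.1)`, where `w t ≤ w (g z.1)`.
        calc _ ≤ ∫⁻ t, (Set.Ico (g z.2) (g z.1)).indicator (fun _ => w (g z.1)) t := by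
              refine lintegral_mono fun t => ?_
              simp only [Set.indicator_apply, Set.mem_ofPred_eq, Set.mem_Ico]
              by_cases h : t < g z.1 ∧ g z.2 ≤ t
              · rw [if_pos h, if_pos h.symm]
                exact hw h.1.le
              · rw [if_neg h]
                exact zero_le
          _ = _ := by
              rw [lintegral_indicator_const measurableSet_Ico, Real.volume_Ico, mul_comm]

end Modified

/-- A lower bound in the layer cake formula. -/
theorem lintegral_half_le_lintegral_meas (π : Measure E) [SFinite π] {g : E → ℝ}
    (hg : Measurable g) {u : ℝ → ℝ≥0∞} (hu : Monotone u) :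
    ∫⁻ x, ENNReal.ofReal (g x / 2) * u (g x / 2) ∂π ≤ ∫⁻ t, u t * π {x | t < g x} := by
  have hum := hu.measurable
  have hset : MeasurableSet {p : ℝ × E | p.1 < g p.2} :=
    measurableSet_lt (by fun_prop) (by fun_prop)
  calc ∫⁻ x, ENNReal.ofReal (g x / 2) * u (g x / 2) ∂π
      ≤ ∫⁻ x, (∫⁻ t : ℝ, {p : ℝ × E | p.1 < g p.2}.indicator (fun p => u p.1) (t, x)) ∂π := by
        refine lintegral_mono fun x => ?_
        -- Only the levels in `[g x / 2, g x)` are kept; there `u` is at least `u (g x / 2)`.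
        calc _ = ∫⁻ t, (Set.Ico (g x / 2) (g x)).indicator (fun _ => u (g x / 2)) t := by
              rw [lintegral_indicator_const measurableSet_Ico, Real.volume_Ico, mul_comm]
              congr 2
              ring
          _ ≤ _ := by
              refine lintegral_mono fun t => ?_
              simp only [Set.indicator_apply, Set.mem_ofPred_eq, Set.mem_Ico]
              by_cases h : g x / 2 ≤ t ∧ t < g x
              · rw [if_pos h, if_pos h.2]
                exact hu h.1
              · rw [if_neg h]
                exact zero_le
    _ = ∫⁻ t, ∫⁻ x, {p : ℝ × E | p.1 < g p.2}.indicator (fun p => u p.1) (t, x) ∂π := by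
        refine (lintegral_lintegral_swap ?_).symm
        exact (Measurable.indicator (by fun_prop) hset).aemeasurable
    _ = ∫⁻ t, u t * π {x | t < g x} := by
        refine lintegral_congr fun t => ?_
        rw [← lintegral_indicator_const (measurableSet_lt measurable_const hg)]
        refine lintegral_congr fun z => ?_
        simp [Set.indicator_apply]

/-- Cheeger's method: an isoperimetric inequality for the level sets of `g` gives an inequality
between the energy and the integrals of `g`. -/
theorem sq_lintegral_le_of_isoperimetric {π : Measure E} [IsFiniteMeasure π]
    {J : Measure (E × E)} {r : E × E → ℝ≥0} (hr : Measurable r)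
    (hnorm : (modified J r 1).fst ≤ π) {g : E → ℝ} (hg : Measurable g) {w κ : ℝ → ℝ≥0∞}
    (hw : Monotone w) (hκ : Monotone κ)
    (H : ∀ t, w t ≠ 0 →
      κ t * π {x | t < g x} ≤ modified J r (1 / 2) ({x | t < g x} ×ˢ {x | t < g x}ᶜ)) :
    (∫⁻ x, ENNReal.ofReal (g x / 2) * (w (g x / 2) * κ (g x / 2)) ∂π) ^ 2 ≤
      2 * energy J g * ∫⁻ x, w (g x) ^ 2 ∂π := by
  refine le_trans (pow_le_pow_left' ?_ 2) (sq_lintegral_boundary_le hr hnorm hg hw)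
  refine (lintegral_half_le_lintegral_meas π hg (hw.mul' hκ)).trans (lintegral_mono fun t => ?_)
  -- No isoperimetry is needed where `w` vanishes; the logarithmic case uses this to discard low
  -- levels.
  by_cases h : w t = 0
  · simp [h]
  · rw [mul_assoc]
    gcongr
    exact H t h

/-! ### Medians -/

/-- The infimum of the levels `t` with `π(f > t) ≤ 1/2` works: these levels form an up-set, nonempty
and bounded below, and continuity of the measure along increasing unions gives both inequalities at
the infimum. -/
theorem exists_median (π : Measure E) [IsProbabilityMeasure π] {f : E → ℝ} (hf : Measurable f) :
    ∃ c : ℝ, π {x | c < f x} ≤ 1 / 2 ∧ π {x | f x < c} ≤ 1 / 2 := by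
  have : IsProbabilityMeasure (π.map f) := Measure.isProbabilityMeasure_map hf.aemeasurable
  set μ := π.map f with hμ
  have hIoi : ∀ c, π {x | c < f x} = μ (Set.Ioi c) := fun c => by
    rw [hμ, Measure.map_apply hf measurableSet_Ioi]; rfl
  have hIio : ∀ c, π {x | f x < c} = μ (Set.Iio c) := fun c => by
    rw [hμ, Measure.map_apply hf measurableSet_Iio]; rfl
  simp only [hIoi, hIio]
  set S : Set ℝ := {t | μ (Set.Ioi t) ≤ 1 / 2} with hS
  have hup : ∀ s ∈ S, ∀ t, s ≤ t → t ∈ S := fun s hs t hst =>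
    (measure_mono (Set.Ioi_subset_Ioi hst)).trans hs
  have hhalf : (1 / 2 : ℝ≥0∞) < 1 := by
    rw [one_div]; exact ENNReal.inv_lt_one.2 (by norm_num)
  have hne : S.Nonempty := by
    have h := tendsto_measure_iInter_atTop (μ := μ) (s := fun n : ℕ => Set.Ioi (n : ℝ))
      (fun n => measurableSet_Ioi.nullMeasurableSet)
      (fun m n hmn => Set.Ioi_subset_Ioi (by exact_mod_cast hmn)) ⟨0, measure_ne_top _ _⟩
    have hempty : ⋂ n : ℕ, Set.Ioi (n : ℝ) = ∅ := by
      ext x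
      simp only [Set.mem_iInter, Set.mem_Ioi, Set.mem_empty_iff_false, iff_false, not_forall,
        not_lt]
      exact exists_nat_ge x
    rw [hempty, measure_empty] at h
    obtain ⟨n, hn⟩ := (h.eventually_lt_const (u := 1 / 2) (by simp)).exists
    exact ⟨n, hn.le⟩
  have hbdd : BddBelow S := by
    have h := tendsto_measure_iUnion_atTop (μ := μ) (s := fun n : ℕ => Set.Ioi (-(n : ℝ)))
      (fun m n hmn => Set.Ioi_subset_Ioi (by simpa using hmn))
    have huniv : ⋃ n : ℕ, Set.Ioi (-(n : ℝ)) = Set.univ := by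
      ext x
      simp only [Set.mem_iUnion, Set.mem_Ioi, Set.mem_univ, iff_true]
      obtain ⟨n, hn⟩ := exists_nat_gt (-x)
      exact ⟨n, by linarith⟩
    rw [huniv, measure_univ] at h
    obtain ⟨n, hn⟩ := (h.eventually_const_lt (u := 1 / 2) hhalf).exists
    refine ⟨-(n : ℝ), fun t ht => ?_⟩
    by_contra hlt
    exact absurd (hup t ht _ (not_le.1 hlt).le) (not_le.2 hn)
  refine ⟨sInf S, ?_, ?_⟩
  · have h : Set.Ioi (sInf S) = ⋃ n : ℕ, Set.Ioi (sInf S + 1 / ((n : ℝ) + 1)) := by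
      ext x
      simp only [Set.mem_iUnion, Set.mem_Ioi]
      constructor
      · intro hx
        obtain ⟨n, hn⟩ := exists_nat_one_div_lt (sub_pos.2 hx)
        exact ⟨n, by linarith⟩
      · rintro ⟨n, hn⟩
        have : 0 < 1 / ((n : ℝ) + 1) := by positivity
        linarith
    have hmono : Monotone fun n : ℕ => Set.Ioi (sInf S + 1 / ((n : ℝ) + 1)) := by
      intro m n hmn
      refine Set.Ioi_subset_Ioi ?_
      gcongr
    rw [h, hmono.measure_iUnion]
    refine iSup_le fun n => ?_
    obtain ⟨s, hs, hlt⟩ := exists_lt_of_csInf_lt hne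
      (show sInf S < sInf S + 1 / ((n : ℝ) + 1) by simp; positivity)
    exact hup s hs _ hlt.le
  · have h : Set.Iio (sInf S) = ⋃ n : ℕ, Set.Iic (sInf S - 1 / ((n : ℝ) + 1)) := by
      ext x
      simp only [Set.mem_iUnion, Set.mem_Iio, Set.mem_Iic]
      constructor
      · intro hx
        obtain ⟨n, hn⟩ := exists_nat_one_div_lt (sub_pos.2 hx)
        exact ⟨n, by linarith⟩
      · rintro ⟨n, hn⟩
        have : 0 < 1 / ((n : ℝ) + 1) := by positivity
        linarith
    have hmono : Monotone fun n : ℕ => Set.Iic (sInf S - 1 / ((n : ℝ) + 1)) := by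
      intro m n hmn
      refine Set.Iic_subset_Iic.2 ?_
      gcongr
    rw [h, hmono.measure_iUnion]
    refine iSup_le fun n => ?_
    have hnot : sInf S - 1 / ((n : ℝ) + 1) ∉ S := fun hmem => by
      have := csInf_le hbdd hmem
      have : 0 < 1 / ((n : ℝ) + 1) := by positivity
      linarith
    have h1 : 1 / 2 < μ (Set.Ioi (sInf S - 1 / ((n : ℝ) + 1))) := not_le.1 hnot
    rw [← Set.compl_Ioi, prob_compl_eq_one_sub measurableSet_Ioi]
    refine (tsub_le_tsub_left h1.le 1).trans ?_
    simp [ENNReal.one_sub_inv_two]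

theorem ofReal_variance_le_lintegral {π : Measure E} [IsProbabilityMeasure π] {f : E → ℝ}
    (hf : MemLp f 2 π) (c : ℝ) :
    ENNReal.ofReal (variance f π) ≤ ∫⁻ x, ENNReal.ofReal ((f x - c) ^ 2) ∂π := by
  have hfc : MemLp (fun x => f x - c) 2 π := hf.sub (memLp_const c)
  rw [← ofReal_integral_eq_lintegral_ofReal hfc.integrable_sq
    (ae_of_all _ fun x => sq_nonneg _), ← variance_sub_const hf.aestronglyMeasurable c]
  exact ENNReal.ofReal_le_ofReal (variance_le_expectation_sq hfc.aestronglyMeasurable)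

theorem eLpNorm_one_eq_lintegral_ofReal_abs (π : Measure E) (f : E → ℝ) :
    eLpNorm f 1 π = ∫⁻ x, ENNReal.ofReal |f x| ∂π := by
  rw [eLpNorm_one_eq_lintegral_enorm]
  simp_rw [Real.enorm_eq_ofReal_abs]

/-- A median is bounded by twice the `L¹` norm. -/
theorem ofReal_abs_median_le {π : Measure E} [IsProbabilityMeasure π] {f : E → ℝ}
    (hf : Measurable f) {c : ℝ} (h1 : π {x | c < f x} ≤ 1 / 2) (h2 : π {x | f x < c} ≤ 1 / 2) :
    ENNReal.ofReal |c| ≤ 2 * eLpNorm f 1 π := by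
  have key : 1 / 2 ≤ π {x | ENNReal.ofReal |c| ≤ ENNReal.ofReal |f x|} := by
    have hstep : ∀ A : Set E, MeasurableSet A → π A ≤ 1 / 2 →
        Aᶜ ⊆ {x | ENNReal.ofReal |c| ≤ ENNReal.ofReal |f x|} →
        1 / 2 ≤ π {x | ENNReal.ofReal |c| ≤ ENNReal.ofReal |f x|} := by
      intro A hA hle hsub
      refine le_trans ?_ (measure_mono hsub)
      rw [prob_compl_eq_one_sub hA]
      refine le_trans ?_ (tsub_le_tsub_left hle 1)
      simp [ENNReal.one_sub_inv_two]
    rcases le_total 0 c with hc | hc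
    · refine hstep _ (measurableSet_lt hf measurable_const) h2 fun x hx => ?_
      have : c ≤ f x := by simpa using hx
      exact ENNReal.ofReal_le_ofReal (abs_le_abs_of_nonneg hc this)
    · refine hstep _ (measurableSet_lt measurable_const hf) h1 fun x hx => ?_
      have : f x ≤ c := by simpa using hx
      exact ENNReal.ofReal_le_ofReal (abs_le_abs_of_nonpos hc this)
  have hM := mul_meas_ge_le_lintegral (μ := π) (f := fun x => ENNReal.ofReal |f x|)
    (by fun_prop) (ENNReal.ofReal |c|)
  rw [← eLpNorm_one_eq_lintegral_ofReal_abs] at hM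
  calc ENNReal.ofReal |c| = 2 * (ENNReal.ofReal |c| * (1 / 2)) := by
        rw [mul_left_comm, one_div, ENNReal.mul_inv_cancel (by simp) (by simp), mul_one]
    _ ≤ 2 * eLpNorm f 1 π := by
        gcongr
        exact le_trans (by gcongr) hM

/-- Reduction of a functional inequality to nonnegative functions with small support. -/
theorem exists_decomposition_at_median {π : Measure E} [IsProbabilityMeasure π]
    (J : Measure (E × E)) {f : E → ℝ} (hf : Measurable f) (hf2 : MemLp f 2 π) :
    ∃ g h : E → ℝ, (∀ u ∈ ({g, h} : Set (E → ℝ)), Measurable u ∧ (∀ x, 0 ≤ u x) ∧ MemLp u 2 π ∧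
      π {x | 0 < u x} ≤ 1 / 2 ∧ energy J u ≤ energy J f ∧
      ∫⁻ x, ENNReal.ofReal (u x) ∂π ≤ 3 * eLpNorm f 1 π) ∧
      ENNReal.ofReal (variance f π) ≤
        ∫⁻ x, ENNReal.ofReal (g x ^ 2) ∂π + ∫⁻ x, ENNReal.ofReal (h x ^ 2) ∂π := by
  obtain ⟨c, h1, h2⟩ := exists_median π hf
  have hL1 : ∫⁻ x, ENNReal.ofReal |f x - c| ∂π ≤ 3 * eLpNorm f 1 π := by
    calc ∫⁻ x, ENNReal.ofReal |f x - c| ∂π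
        ≤ ∫⁻ x, (ENNReal.ofReal |f x| + ENNReal.ofReal |c|) ∂π := by
          refine lintegral_mono fun x => ?_
          rw [← ENNReal.ofReal_add (abs_nonneg _) (abs_nonneg _)]
          exact ENNReal.ofReal_le_ofReal (abs_sub _ _)
      _ = eLpNorm f 1 π + ENNReal.ofReal |c| := by
          rw [lintegral_add_right _ measurable_const, eLpNorm_one_eq_lintegral_ofReal_abs]
          simp
      _ ≤ eLpNorm f 1 π + 2 * eLpNorm f 1 π := by
          gcongr
          exact ofReal_abs_median_le hf h1 h2
      _ = 3 * eLpNorm f 1 π := by ring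
  have hfc : MemLp (fun x => f x - c) 2 π := hf2.sub (memLp_const c)
  have hm : ∀ a b : ℝ, (max a 0 - max b 0) ^ 2 ≤ (a - b) ^ 2 := fun a b =>
    sq_le_sq.2 (by simpa using abs_max_sub_max_le_abs a b 0)
  -- The positive and negative parts of `f - c` are contractions of `f` with disjoint supports, so
  -- their squares add up to `(f - c)²`.
  refine ⟨fun x => max (f x - c) 0, fun x => max (c - f x) 0, ?_, ?_⟩
  · rintro u (rfl | rfl)
    · refine ⟨by fun_prop, fun x => le_max_right _ _, ?_, ?_, ?_, ?_⟩
      · refine hfc.mono (by fun_prop) (ae_of_all _ fun x => ?_)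
        rw [Real.norm_eq_abs, Real.norm_eq_abs, abs_of_nonneg (le_max_right _ _)]
        exact max_le (le_abs_self _) (abs_nonneg _)
      · simpa using h1
      · exact energy_mono_of_forall J fun x y => (hm _ _).trans (by simp)
      · refine (lintegral_mono fun x => ENNReal.ofReal_le_ofReal ?_).trans hL1
        exact max_le (le_abs_self _) (abs_nonneg _)
    · refine ⟨by fun_prop, fun x => le_max_right _ _, ?_, ?_, ?_, ?_⟩
      · refine hfc.mono (by fun_prop) (ae_of_all _ fun x => ?_)
        rw [Real.norm_eq_abs, Real.norm_eq_abs, abs_of_nonneg (le_max_right _ _), abs_sub_comm]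
        exact max_le (le_abs_self _) (abs_nonneg _)
      · simpa using h2
      · exact energy_mono_of_forall J fun x y => (hm _ _).trans (le_of_eq (by ring))
      · refine (lintegral_mono fun x => ENNReal.ofReal_le_ofReal ?_).trans hL1
        rw [abs_sub_comm]
        exact max_le (le_abs_self _) (abs_nonneg _)
  · refine (ofReal_variance_le_lintegral hf2 c).trans ?_
    rw [← lintegral_add_left (by fun_prop)]
    refine lintegral_mono fun x => ?_
    rw [← ENNReal.ofReal_add (sq_nonneg _) (sq_nonneg _)]
    refine ENNReal.ofReal_le_ofReal ?_
    beta_reduce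
    rcases le_total (f x) c with h | h
    · rw [max_eq_right (by linarith), max_eq_left (by linarith)]
      exact le_of_eq (by ring)
    · rw [max_eq_left (by linarith), max_eq_right (by linarith)]
      exact le_of_eq (by ring)

theorem lintegral_ofReal_sq_ne_top {π : Measure E} {f : E → ℝ} (hf : MemLp f 2 π) :
    ∫⁻ x, ENNReal.ofReal (f x ^ 2) ∂π ≠ ∞ := hf.integrable_sq.lintegral_lt_top.ne

theorem poincareInequality_of_forall_nonneg {π : Measure E} [IsProbabilityMeasure π]
    {J : Measure (E × E)} {C : ℝ} (hC : 0 < C)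
    (H : ∀ g : E → ℝ, Measurable g → (∀ x, 0 ≤ g x) → MemLp g 2 π → π {x | 0 < g x} ≤ 1 / 2 →
      ∫⁻ x, ENNReal.ofReal (g x ^ 2) ∂π ≤ ENNReal.ofReal C * energy J g) :
    PoincareInequality π J := by
  refine ⟨2 * C, by positivity, fun f hf hf2 => ?_⟩
  obtain ⟨g, h, hgh, hvar⟩ := exists_decomposition_at_median J hf hf2
  have hu : ∀ u ∈ ({g, h} : Set (E → ℝ)),
      ∫⁻ x, ENNReal.ofReal (u x ^ 2) ∂π ≤ ENNReal.ofReal C * energy J f := by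
    intro u hu
    obtain ⟨hum, hu0, hu2, hsupp, hen, -⟩ := hgh u hu
    exact (H u hum hu0 hu2 hsupp).trans (by gcongr)
  refine (hvar.trans (add_le_add (hu g (by simp)) (hu h (by simp)))).trans ?_
  rw [← two_mul, ENNReal.ofReal_mul (by norm_num), mul_assoc]
  simp

/-! ### Poincaré inequality -/

section Cheeger

variable {π : Measure E} [IsProbabilityMeasure π] {J : Measure (E × E)} {r : E × E → ℝ≥0}

/-- Cheeger's inequality. -/
theorem lintegral_sq_le_of_isoperimetric (hr : Measurable r) (hnorm : (modified J r 1).fst ≤ π)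
    {g : E → ℝ} (hg : Measurable g) (hg0 : ∀ x, 0 ≤ g x) (hg2 : MemLp g 2 π) {k : ℝ} (hk : 0 < k)
    (H : ∀ t, 0 < t → ENNReal.ofReal k * π {x | t < g x} ≤
      modified J r (1 / 2) ({x | t < g x} ×ˢ {x | t < g x}ᶜ)) :
    ∫⁻ x, ENNReal.ofReal (g x ^ 2) ∂π ≤ ENNReal.ofReal (32 / k ^ 2) * energy J g := by
  -- With `w(t) = t₊` and `κ = k`, both sides involve only `Q = ∫ g²`: `(k Q / 4)² ≤ 2 D Q`. One
  -- factor `Q`, finite since `g ∈ L²`, cancels.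
  have h := sq_lintegral_le_of_isoperimetric hr hnorm hg (w := ENNReal.ofReal)
    (κ := fun _ => ENNReal.ofReal k) (fun a b hab => ENNReal.ofReal_le_ofReal hab)
    monotone_const (fun t ht => H t (by simpa using ht))
  have hQ := lintegral_ofReal_sq_ne_top hg2
  have e1 : ∀ x, ENNReal.ofReal (g x / 2) * (ENNReal.ofReal (g x / 2) * ENNReal.ofReal k) =
      ENNReal.ofReal (k / 4) * ENNReal.ofReal (g x ^ 2) := by
    intro x
    have := hg0 x
    rw [← ENNReal.ofReal_mul (by positivity), ← ENNReal.ofReal_mul (by positivity),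
      ← ENNReal.ofReal_mul (by positivity)]
    congr 1
    ring
  have e2 : ∀ x, ENNReal.ofReal (g x) ^ 2 = ENNReal.ofReal (g x ^ 2) := fun x =>
    (ENNReal.ofReal_pow (hg0 x) 2).symm
  simp_rw [e1, e2] at h
  rw [lintegral_const_mul' _ _ ENNReal.ofReal_ne_top] at h
  set Q := ∫⁻ x, ENNReal.ofReal (g x ^ 2) ∂π
  rcases eq_or_ne Q 0 with h0 | h0
  · simp [h0]
  have h3 : ENNReal.ofReal (k ^ 2 / 16) * Q ≤ 2 * energy J g := by
    refine (ENNReal.mul_le_mul_iff_left h0 hQ).1 (le_trans (le_of_eq ?_) h)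
    rw [mul_pow, ← ENNReal.ofReal_pow (by positivity), div_pow]
    norm_num
    ring
  calc Q = ENNReal.ofReal (16 / k ^ 2) * (ENNReal.ofReal (k ^ 2 / 16) * Q) := by
        rw [← mul_assoc, ← ENNReal.ofReal_mul (by positivity)]
        rw [show 16 / k ^ 2 * (k ^ 2 / 16) = 1 by field_simp]
        simp
    _ ≤ ENNReal.ofReal (16 / k ^ 2) * (2 * energy J g) := by gcongr
    _ = ENNReal.ofReal (32 / k ^ 2) * energy J g := by
        rw [← mul_assoc, show (2 : ℝ≥0∞) = ENNReal.ofReal 2 by simp,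
          ← ENNReal.ofReal_mul (by positivity)]
        congr 2
        ring

theorem exists_ofReal_le_of_pos {a : ℝ≥0∞} (ha : 0 < a) : ∃ k : ℝ, 0 < k ∧ ENNReal.ofReal k ≤ a := by
  obtain ⟨k, hk0, hk⟩ := ENNReal.lt_iff_exists_real_btwn.1 ha
  exact ⟨k, by simpa using hk.1, hk.2.le⟩

theorem poincareInequality_of_poincareConst_pos (hr : Measurable r)
    (hnorm : (modified J r 1).fst ≤ π) (h : 0 < poincareConst π (modified J r (1 / 2))) :
    PoincareInequality π J := by
  obtain ⟨k, hk, hkle⟩ := exists_ofReal_le_of_pos h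
  refine poincareInequality_of_forall_nonneg (C := 32 / k ^ 2) (by positivity) ?_
  intro g hg hg0 hg2 hsupp
  refine lintegral_sq_le_of_isoperimetric hr hnorm hg hg0 hg2 hk fun t ht => ?_
  set A := {x | t < g x}
  have hA : MeasurableSet A := measurableSet_lt measurable_const hg
  have hA2 : π A ≤ 1 / 2 := (measure_mono fun x (hx : t < g x) => ht.trans hx).trans hsupp
  have hA1 : π A < 1 := hA2.trans_lt (by rw [one_div]; exact ENNReal.inv_lt_one.2 (by norm_num))
  rcases eq_or_ne (π A) 0 with h0 | h0
  · simp [h0]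
  have hmin : min (π A) (π Aᶜ) = π A := by
    refine min_eq_left (hA2.trans ?_)
    rw [prob_compl_eq_one_sub hA]
    refine le_trans ?_ (tsub_le_tsub_left hA2 1)
    simp [ENNReal.one_sub_inv_two]
  have h1 : ENNReal.ofReal k ≤ modified J r (1 / 2) (A ×ˢ Aᶜ) / π A := by
    refine hkle.trans ?_
    unfold poincareConst
    refine (iInf₂_le_of_le A hA (iInf₂_le_of_le (pos_iff_ne_zero.2 h0) hA1 ?_))
    rw [hmin]
  exact ENNReal.mul_le_of_le_div h1

end Cheeger

/-! ### Nash inequality -/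

section Nash

variable {π : Measure E} {J : Measure (E × E)} {r : E × E → ℝ≥0}

theorem ofReal_mul_measure_le_lintegral {g : E → ℝ} (hg : Measurable g) (t : ℝ) :
    ENNReal.ofReal t * π {x | t < g x} ≤ ∫⁻ x, ENNReal.ofReal (g x) ∂π := by
  refine le_trans ?_ (mul_meas_ge_le_lintegral (μ := π) (f := fun x => ENNReal.ofReal (g x))
    (by fun_prop) (ENNReal.ofReal t))
  gcongr with x
  exact fun hx => ENNReal.ofReal_le_ofReal hx.le

/-- The real arithmetic which turns the bound for the moment of order `2 + α` and the
interpolation of `L²` between `L¹` and `L^(2 + α)` into the Nash inequality. -/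
theorem nash_arithmetic {k n α Q P D : ℝ} (hk : 0 < k) (hn : 0 < n) (hα : 0 < α) (hQ : 0 < Q)
    (hD : 0 ≤ D) (h1 : (k * P) ^ 2 ≤ 2 * D * Q)
    (h2 : Q ≤ 8 * (4 * n ^ 2 / Q) ^ α * P) :
    Q ≤ (128 * 4 ^ (2 * α) / k ^ 2) ^ (1 / (1 + 2 * α)) * D ^ (1 / (1 + 2 * α)) *
      n ^ (4 * α / (1 + 2 * α)) := by
  have hβ : 0 < 1 + 2 * α := by positivity
  have h3 : Q ^ 2 ≤ 64 * (4 ^ (2 * α) * n ^ (4 * α) / Q ^ (2 * α)) * P ^ 2 := by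
    have e : ((4 * n ^ 2 / Q) ^ α) ^ 2 = 4 ^ (2 * α) * n ^ (4 * α) / Q ^ (2 * α) := by
      rw [← Real.rpow_natCast, ← Real.rpow_mul (by positivity),
        Real.div_rpow (by positivity) hQ.le, Real.mul_rpow (by positivity) (by positivity),
        ← Real.rpow_natCast n 2, ← Real.rpow_mul hn.le]
      push_cast
      ring_nf
    calc Q ^ 2 ≤ (8 * (4 * n ^ 2 / Q) ^ α * P) ^ 2 := by gcongr
      _ = 64 * ((4 * n ^ 2 / Q) ^ α) ^ 2 * P ^ 2 := by ring
      _ = _ := by rw [e]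
  have hP2 : P ^ 2 ≤ 2 * D * Q / k ^ 2 := by
    rw [le_div_iff₀ (by positivity)]
    linarith [mul_pow k P 2]
  -- Insert the bound for `P²` into the squared interpolation bound, move `Q^(2α)` to the left and
  -- cancel one `Q`.
  have h4 : Q ^ (1 + 2 * α) ≤ 128 * 4 ^ (2 * α) / k ^ 2 * D * n ^ (4 * α) := by
    have h5 : Q ^ 2 ≤ 64 * (4 ^ (2 * α) * n ^ (4 * α) / Q ^ (2 * α)) * (2 * D * Q / k ^ 2) :=
      h3.trans (by gcongr)
    have hQa : 0 < Q ^ (2 * α) := by positivity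
    rw [Real.rpow_add hQ, Real.rpow_one]
    have h6 : Q * (Q * Q ^ (2 * α)) ≤ Q * (128 * 4 ^ (2 * α) / k ^ 2 * D * n ^ (4 * α)) := by
      calc Q * (Q * Q ^ (2 * α)) = Q ^ 2 * Q ^ (2 * α) := by ring
        _ ≤ 64 * (4 ^ (2 * α) * n ^ (4 * α) / Q ^ (2 * α)) * (2 * D * Q / k ^ 2) *
            Q ^ (2 * α) := by gcongr
        _ = _ := by field_simp; ring
    exact le_of_mul_le_mul_left h6 hQ
  calc Q = (Q ^ (1 + 2 * α)) ^ (1 / (1 + 2 * α)) := by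
        rw [← Real.rpow_mul hQ.le, mul_one_div_cancel hβ.ne', Real.rpow_one]
    _ ≤ (128 * 4 ^ (2 * α) / k ^ 2 * D * n ^ (4 * α)) ^ (1 / (1 + 2 * α)) := by gcongr
    _ = _ := by
        rw [Real.mul_rpow (by positivity) (by positivity), Real.mul_rpow (by positivity) hD,
          ← Real.rpow_mul hn.le]
        congr 2
        ring

/-- Below the threshold `s` the first term suffices. Above it the second equals `g² (g / s)^α`, and
the last factor is at least 1. -/
theorem sq_le_interpolation {g n α s : ℝ} (hg : 0 ≤ g) (hn : 0 < n) (hα : 0 < α) (hs : 0 < s) :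
    g ^ 2 ≤ s * g + 4 * (2 * n / s) ^ α * ((g / 2) ^ 2 * (g / 2 / n) ^ α) := by
  rcases le_total g s with h | h
  · have : 0 ≤ 4 * (2 * n / s) ^ α * ((g / 2) ^ 2 * (g / 2 / n) ^ α) := by positivity
    nlinarith
  · have h1 : 1 ≤ (2 * n / s) ^ α * (g / 2 / n) ^ α := by
      rw [← Real.mul_rpow (by positivity) (by positivity)]
      refine Real.one_le_rpow ?_ hα.le
      rw [show 2 * n / s * (g / 2 / n) = g / s by field_simp]
      exact (one_le_div hs).2 h
    have h2 : 0 ≤ s * g := by positivity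
    nlinarith [sq_nonneg g]

/-- By Markov, `π(g > t) ≤ n / t`, so `π(A)^(1 - α) ≥ (t / n)^α π(A)` for `A = {g > t}`. Cheeger's
method with `κ(t) = k (t / n)^α` then bounds the moment of order `2 + α`, and L² is interpolated
between it and L¹. -/
theorem lintegral_sq_le_nash [IsProbabilityMeasure π] (hr : Measurable r)
    (hnorm : (modified J r 1).fst ≤ π)
    {g : E → ℝ} (hg : Measurable g) (hg0 : ∀ x, 0 ≤ g x) (hg2 : MemLp g 2 π) {k n α : ℝ}
    (hk : 0 < k) (hn : 0 < n) (hα : 0 < α)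
    (hgn : ∫⁻ x, ENNReal.ofReal (g x) ∂π ≤ ENNReal.ofReal n)
    (H : ∀ t, 0 < t → π {x | t < g x} ≠ 0 → ENNReal.ofReal k * π {x | t < g x} ^ (1 - α) ≤
      modified J r (1 / 2) ({x | t < g x} ×ˢ {x | t < g x}ᶜ)) :
    ∫⁻ x, ENNReal.ofReal (g x ^ 2) ∂π ≤
      ENNReal.ofReal ((128 * 4 ^ (2 * α) / k ^ 2) ^ (1 / (1 + 2 * α))) *
        energy J g ^ (1 / (1 + 2 * α)) * ENNReal.ofReal n ^ (4 * α / (1 + 2 * α)) := by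
  have h := sq_lintegral_le_of_isoperimetric hr hnorm hg (w := ENNReal.ofReal)
    (κ := fun t => ENNReal.ofReal (k * (max t 0 / n) ^ α))
    (fun a b hab => ENNReal.ofReal_le_ofReal hab)
    (fun a b hab => ENNReal.ofReal_le_ofReal (by gcongr)) ?_
  swap
  · intro t ht
    have ht : 0 < t := by simpa using ht
    rcases eq_or_ne (π {x | t < g x}) 0 with h0 | h0
    · simp [h0]
    refine le_trans ?_ (H t ht h0)
    have hM := (ofReal_mul_measure_le_lintegral (π := π) hg t).trans hgn
    have hu : π {x | t < g x} = ENNReal.ofReal (π.real {x | t < g x}) := by simp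
    have hu0 : 0 < π.real {x | t < g x} := ENNReal.toReal_pos h0 (by simp)
    rw [hu] at hM ⊢
    set u := π.real {x | t < g x}
    rw [← ENNReal.ofReal_mul ht.le, ENNReal.ofReal_le_ofReal_iff hn.le] at hM
    rw [ENNReal.ofReal_rpow_of_pos hu0, ← ENNReal.ofReal_mul (by positivity),
      ← ENNReal.ofReal_mul (by positivity), max_eq_left ht.le]
    refine ENNReal.ofReal_le_ofReal ?_
    rw [mul_assoc]
    gcongr
    rw [Real.rpow_sub hu0, Real.rpow_one, le_div_iff₀ (by positivity)]
    have : (t / n) ^ α * u ^ α ≤ 1 := by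
      rw [← Real.mul_rpow (by positivity) hu0.le]
      refine Real.rpow_le_one (by positivity) ?_ hα.le
      rw [div_mul_eq_mul_div]
      exact (div_le_one hn).2 hM
    nlinarith
  have hQt := lintegral_ofReal_sq_ne_top hg2
  have e1 : ∀ x, ENNReal.ofReal (g x / 2) * (ENNReal.ofReal (g x / 2) *
      ENNReal.ofReal (k * (max (g x / 2) 0 / n) ^ α)) =
      ENNReal.ofReal k * ENNReal.ofReal ((g x / 2) ^ 2 * (g x / 2 / n) ^ α) := by
    intro x
    have := hg0 x
    have : 0 ≤ g x / 2 := by positivity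
    rw [max_eq_left this, ← ENNReal.ofReal_mul (by positivity),
      ← ENNReal.ofReal_mul (by positivity), ← ENNReal.ofReal_mul (by positivity)]
    congr 1
    ring
  have e2 : ∀ x, ENNReal.ofReal (g x) ^ 2 = ENNReal.ofReal (g x ^ 2) := fun x =>
    (ENNReal.ofReal_pow (hg0 x) 2).symm
  simp_rw [e1, e2] at h
  rw [lintegral_const_mul' _ _ ENNReal.ofReal_ne_top] at h
  have hinterp : ∀ s : ℝ, 0 < s → ∫⁻ x, ENNReal.ofReal (g x ^ 2) ∂π ≤
      ENNReal.ofReal (s * n) + ENNReal.ofReal (4 * (2 * n / s) ^ α) *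
        ∫⁻ x, ENNReal.ofReal ((g x / 2) ^ 2 * (g x / 2 / n) ^ α) ∂π := by
    intro s hs
    calc _ ≤ ∫⁻ x, (ENNReal.ofReal s * ENNReal.ofReal (g x) + ENNReal.ofReal
            (4 * (2 * n / s) ^ α) * ENNReal.ofReal ((g x / 2) ^ 2 * (g x / 2 / n) ^ α)) ∂π := by
          refine lintegral_mono fun x => ?_
          have := hg0 x
          rw [← ENNReal.ofReal_mul hs.le, ← ENNReal.ofReal_mul (by positivity),
            ← ENNReal.ofReal_add (by positivity) (by positivity)]
          exact ENNReal.ofReal_le_ofReal (sq_le_interpolation this hn hα hs)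
      _ ≤ _ := by
          rw [lintegral_add_left (by fun_prop), lintegral_const_mul' _ _ ENNReal.ofReal_ne_top,
            lintegral_const_mul' _ _ ENNReal.ofReal_ne_top, ENNReal.ofReal_mul hs.le]
          gcongr
  set Q := ∫⁻ x, ENNReal.ofReal (g x ^ 2) ∂π
  set P := ∫⁻ x, ENNReal.ofReal ((g x / 2) ^ 2 * (g x / 2 / n) ^ α) ∂π
  rcases eq_or_ne Q 0 with h0 | h0
  · simp [h0]
  have hn' : ENNReal.ofReal n ^ (4 * α / (1 + 2 * α)) ≠ 0 := by
    rw [ENNReal.ofReal_rpow_of_pos hn]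
    simp
    positivity
  rcases eq_or_ne (energy J g) ∞ with hD | hD
  · rw [hD, ENNReal.top_rpow_of_pos (by positivity), ENNReal.mul_top (by simp; positivity),
      ENNReal.top_mul hn']
    exact le_top
  have hP : P ≠ ∞ := by
    intro hP
    rw [hP, ENNReal.mul_top (by simpa using hk)] at h
    have h' : 2 * energy J g * Q = ∞ := top_le_iff.1 (by simpa using h)
    exact absurd h' (ENNReal.mul_ne_top (ENNReal.mul_ne_top (by simp) hD) hQt)
  clear_value Q P
  lift Q to ℝ≥0 using hQt
  lift P to ℝ≥0 using hP
  generalize energy J g = D at *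
  lift D to ℝ≥0 using hD
  have hQ0 : (0 : ℝ) < Q := by
    have : Q ≠ 0 := by simpa using h0
    exact_mod_cast pos_iff_ne_zero.2 this
  have h1 : (k * P) ^ 2 ≤ 2 * (D : ℝ) * Q := by
    have := ENNReal.toReal_mono (by finiteness) h
    simpa [hk.le] using this
  have h2 : (Q : ℝ) ≤ 8 * (4 * n ^ 2 / Q) ^ α * P := by
    -- The threshold `s = Q / (2n)` makes `s n = Q / 2`, which the left side absorbs.
    have := ENNReal.toReal_mono (by finiteness) (hinterp (Q / (2 * n)) (by positivity))
    rw [ENNReal.toReal_add (by finiteness) (by finiteness), ENNReal.toReal_mul,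
      ENNReal.toReal_ofReal (by positivity), ENNReal.toReal_ofReal (by positivity),
      ENNReal.coe_toReal, ENNReal.coe_toReal,
      show (Q : ℝ) / (2 * n) * n = Q / 2 by field_simp,
      show 2 * n / ((Q : ℝ) / (2 * n)) = 4 * n ^ 2 / Q by field_simp; ring] at this
    linarith
  have h3 := nash_arithmetic hk hn hα hQ0 D.coe_nonneg h1 h2
  rw [← ENNReal.ofReal_coe_nnreal, ← ENNReal.ofReal_coe_nnreal,
    ENNReal.ofReal_rpow_of_nonneg D.coe_nonneg (by positivity), ENNReal.ofReal_rpow_of_pos hn,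
    ← ENNReal.ofReal_mul (by positivity), ← ENNReal.ofReal_mul (by positivity)]
  exact ENNReal.ofReal_le_ofReal h3

theorem nashInequality_of_nashConst_pos [IsProbabilityMeasure π] (hr : Measurable r)
   
    (hnorm : (modified J r 1).fst ≤ π) {p q : ℝ} (hpq : p.HolderConjugate q)
    (h : 0 < nashConst π (modified J r (1 / 2)) (2 * (q - 1))) :
    NashInequality π J p q := by
  obtain ⟨k, hk, hkle⟩ := exists_ofReal_le_of_pos h
  have hq : 0 < q - 1 := sub_pos.2 hpq.symm.lt
  have hp0 := hpq.pos
  have hq0 := hpq.symm.pos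
  -- Here `α = 1/ν`, whence `(ν - 1)/ν = 1 - α`, `1 + 2α = p` and `4α / (1 + 2α) = 2/q`.
  set α := 1 / (2 * (q - 1)) with hα
  have hα0 : 0 < α := by positivity
  have hmul : p * (q - 1) = q := by
    have := hpq.mul_eq_add
    linarith
  have hp : 1 + 2 * α = p := by
    rw [hα]
    field_simp
    linarith
  have hq2 : 4 * α / (1 + 2 * α) = 2 / q := by
    rw [hp, hα, div_eq_div_iff hp0.ne' hq0.ne']
    field_simp
    linarith
  set C := (128 * 4 ^ (2 * α) / k ^ 2) ^ (1 / (1 + 2 * α)) with hC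
  have hC0 : 0 < C := by positivity
  refine ⟨2 * C * 3 ^ (2 / q), by positivity, fun f hf hf2 => ?_⟩
  have hNt : eLpNorm f 1 π ≠ ∞ := (hf2.mono_exponent (by norm_num)).2.ne
  rcases eq_or_ne (eLpNorm f 1 π) 0 with h0 | h0
  · have hf0 : f =ᵐ[π] 0 := (eLpNorm_eq_zero_iff hf.aestronglyMeasurable (by simp)).1 h0
    refine (ofReal_variance_le_lintegral hf2 0).trans (le_of_eq_of_le ?_ zero_le)
    rw [lintegral_eq_zero_iff (by fun_prop)]
    filter_upwards [hf0] with x hx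
    simp [hx]
  obtain ⟨g, h, hgh, hvar⟩ := exists_decomposition_at_median J hf hf2
  set n := (3 * eLpNorm f 1 π).toReal
  have hn : ENNReal.ofReal n = 3 * eLpNorm f 1 π := ENNReal.ofReal_toReal (by finiteness)
  have hn0 : 0 < n := ENNReal.toReal_pos (by simp [h0]) (by finiteness)
  have hu : ∀ u ∈ ({g, h} : Set (E → ℝ)), ∫⁻ x, ENNReal.ofReal (u x ^ 2) ∂π ≤
      ENNReal.ofReal C * energy J f ^ (1 / p) * (3 * eLpNorm f 1 π) ^ (2 / q) := by
    intro u hu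
    obtain ⟨hum, hu0, hu2, hsupp, hen, hL⟩ := hgh u hu
    have := lintegral_sq_le_nash hr hnorm hum hu0 hu2 hk hn0 hα0 (hn ▸ hL) ?_
    · rw [← hC, hq2, hp, hn] at this
      exact this.trans (by gcongr)
    intro t ht hne
    set A := {x | t < u x}
    have hA : MeasurableSet A := measurableSet_lt measurable_const hum
    have hA2 : π A ≤ 1 / 2 := (measure_mono fun x (hx : t < u x) => ht.trans hx).trans hsupp
    have hA1 : π A < 1 :=
      hA2.trans_lt (by rw [one_div]; exact ENNReal.inv_lt_one.2 (by norm_num))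
    have hmin : min (π A) (π Aᶜ) = π A := by
      refine min_eq_left (hA2.trans ?_)
      rw [prob_compl_eq_one_sub hA]
      refine le_trans ?_ (tsub_le_tsub_left hA2 1)
      simp [ENNReal.one_sub_inv_two]
    have h1 : ENNReal.ofReal k ≤ modified J r (1 / 2) (A ×ˢ Aᶜ) / π A ^ (1 - α) := by
      refine hkle.trans ?_
      unfold nashConst
      refine (iInf₂_le_of_le A hA (iInf₂_le_of_le (pos_iff_ne_zero.2 hne) hA1 ?_))
      rw [hmin, show (2 * (q - 1) - 1) / (2 * (q - 1)) = 1 - α by rw [hα]; field_simp]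
    exact ENNReal.mul_le_of_le_div h1
  refine (hvar.trans (add_le_add (hu g (by simp)) (hu h (by simp)))).trans (le_of_eq ?_)
  rw [← two_mul, ENNReal.mul_rpow_of_nonneg _ _ (by positivity),
    ENNReal.ofReal_mul (by positivity), ENNReal.ofReal_mul (by norm_num),
    ← ENNReal.ofReal_rpow_of_pos (p := 2 / q) (show (0 : ℝ) < 3 by norm_num)]
  simp only [ENNReal.ofReal_ofNat]
  clear_value C
  ring

end Nash

/-! ### Irreducibility -/

section Irreducible

theorem limsup_le_limsup_of_tendsto_sub {a b : ℕ → ℝ} (ha : ∀ n, a n ∈ Set.Icc (0 : ℝ) 1)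
    (hb : ∀ n, b n ∈ Set.Icc (0 : ℝ) 1) (h : Tendsto (fun n => a n - b n) atTop (𝓝 0)) :
    limsup a atTop ≤ limsup b atTop := by
  have hba : IsBoundedUnder (· ≤ ·) atTop b := isBoundedUnder_of ⟨1, fun n => (hb n).2⟩
  have hbb : IsBoundedUnder (· ≥ ·) atTop b := isBoundedUnder_of ⟨0, fun n => (hb n).1⟩
  have hab : IsBoundedUnder (· ≥ ·) atTop a := isBoundedUnder_of ⟨0, fun n => (ha n).1⟩
  refine le_of_forall_pos_le_add fun ε hε => ?_
  rw [← limsup_add_const atTop b ε hba hbb.isCoboundedUnder_le]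
  refine limsup_le_limsup ?_ hab.isCoboundedUnder_le
    (isBoundedUnder_of ⟨1 + ε, fun n => by have := (hb n).2; simpa using this⟩)
  filter_upwards [h.eventually_lt_const hε] with n hn
  linarith

variable {π : Measure E} {J : Measure (E × E)}

/-- `J` has no mass between `F ⁻¹' U` and its complement, so irreducibility makes every such
preimage null or conull; countably many sets `U` separate the reals. -/
theorem Irreducible.exists_ae_eq_const [IsProbabilityMeasure π] (hirr : Irreducible π J)
    {F : E → ℝ} (hF : Measurable F) (h : ∀ᵐ z ∂J, F z.2 = F z.1) :
    ∃ c, ∀ᵐ x ∂π, F x = c := by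
  obtain ⟨c, hc⟩ := exists_eventuallyEq_const_of_forall_separating (l := ae π) (f := F)
    MeasurableSet (fun U hU => by
      have hA : MeasurableSet (F ⁻¹' U) := hF hU
      by_cases h0 : π (F ⁻¹' U) = 0
      · exact Or.inr (measure_eq_zero_iff_ae_notMem.1 h0)
      · left
        by_contra hne
        have h1 : π (F ⁻¹' U) < 1 := by
          refine lt_of_le_of_ne prob_le_one fun h1 => hne ?_
          exact (mem_ae_iff_prob_eq_one hA).2 h1
        have hpos := hirr _ hA (pos_iff_ne_zero.2 h0) h1
        refine hpos.ne' (measure_mono_null (fun z hz => ?_) (ae_iff.1 h))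
        intro heq
        exact hz.2 (by simpa [heq] using hz.1))
  exact ⟨c, hc⟩

/-- A pointwise limit of functions with summable energies is constant. -/
theorem Irreducible.exists_tendsto_const [IsProbabilityMeasure π] (hirr : Irreducible π J)
    {f : ℕ → E → ℝ} (hf : ∀ n, Measurable (f n)) (hf1 : ∀ n x, f n x ∈ Set.Icc (0 : ℝ) 1)
    (hsum : ∑' n, energy J (f n) ≠ ∞)
    (hlim : ∀ᵐ x ∂π, ∃ l, Tendsto (fun n => f n x) atTop (𝓝 l)) :
    ∃ c, ∀ᵐ x ∂π, Tendsto (fun n => f n x) atTop (𝓝 c) := by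
  have hJ : ∀ᵐ z ∂J, ∑' n, ENNReal.ofReal ((f n z.2 - f n z.1) ^ 2) < ∞ := by
    refine ae_lt_top (Measurable.tsum fun n => measurable_ofReal_sq_sub (hf n)) ?_
    rw [lintegral_tsum fun n => (measurable_ofReal_sq_sub (hf n)).aemeasurable]
    unfold energy at hsum
    rw [ENNReal.tsum_mul_left] at hsum
    intro htop
    rw [htop] at hsum
    simp at hsum
  -- The limit exists only `π`-a.e., which says nothing `J`-a.e.; the limsup is measurable and
  -- defined everywhere, so it can be compared along `J`.
  have hz : ∀ᵐ z ∂J, limsup (fun n => f n z.2) atTop = limsup (fun n => f n z.1) atTop := by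
    filter_upwards [hJ] with z hz
    have h1 : Tendsto (fun n => (f n z.2 - f n z.1) ^ 2) atTop (𝓝 0) := by
      have h2 := ENNReal.tendsto_atTop_zero_of_tsum_ne_top hz.ne
      have h3 := (ENNReal.tendsto_toReal ENNReal.zero_ne_top).comp h2
      refine h3.congr fun n => ?_
      simp [sq_nonneg]
    have h4 : Tendsto (fun n => f n z.2 - f n z.1) atTop (𝓝 0) := by
      rw [tendsto_zero_iff_abs_tendsto_zero]
      have h5 := h1.sqrt
      simpa [Real.sqrt_sq_eq_abs, Function.comp_def] using h5
    refine le_antisymm (limsup_le_limsup_of_tendsto_sub (fun n => hf1 n _) (fun n => hf1 n _) h4)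
      (limsup_le_limsup_of_tendsto_sub (fun n => hf1 n _) (fun n => hf1 n _) ?_)
    simpa using h4.neg
  obtain ⟨c, hc⟩ := hirr.exists_ae_eq_const (Measurable.limsup hf) hz
  refine ⟨c, ?_⟩
  filter_upwards [hc, hlim] with x hx ⟨l, hl⟩
  rwa [← hx, hl.limsup_eq]

theorem integrable_of_forall_abs_le [IsFiniteMeasure π] {f : E → ℝ} (hf : Measurable f) {C : ℝ}
    (h : ∀ x, |f x| ≤ C) : Integrable f π :=
  Integrable.of_bound hf.aestronglyMeasurable C (ae_of_all _ h)

theorem eLpNorm_two_lt_of_integral_sq_lt {f : E → ℝ} (hf : MemLp f 2 π) {b : ℝ} (hb : 0 < b)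
    (h : ∫ x, f x ^ 2 ∂π < b ^ 2) : eLpNorm f 2 π < ENNReal.ofReal b := by
  have h0 : 0 ≤ ∫ x, f x ^ 2 ∂π := integral_nonneg fun x => sq_nonneg _
  rw [hf.eLpNorm_eq_integral_rpow_norm (by simp) (by simp)]
  refine (ENNReal.ofReal_lt_ofReal_iff hb).2 ?_
  simp only [ENNReal.toReal_ofNat, Real.rpow_ofNat, Real.norm_eq_abs, sq_abs]
  rw [← one_div, ← Real.sqrt_eq_rpow, Real.sqrt_lt' hb]
  exact h

/-- Functions of small energy with values in `[0, 1]` are asymptotically uncorrelated with any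
given bounded function. -/
theorem Irreducible.exists_forall_integral_mul_le [IsProbabilityMeasure π]
    (hirr : Irreducible π J) {φ : E → ℝ} (hφ : Measurable φ) (hφ1 : ∀ x, |φ x| ≤ 1)
    (hφ0 : ∫ x, φ x ∂π = 0) {ε : ℝ} (hε : 0 < ε) :
    ∃ δ : ℝ, 0 < δ ∧ ∀ f : E → ℝ, Measurable f → (∀ x, f x ∈ Set.Icc (0 : ℝ) 1) →
      energy J f ≤ ENNReal.ofReal δ → ∫ x, φ x * f x ∂π ≤ ε := by
  -- The counterexamples of energy at most `2^{-n}` form decreasing convex sets. Near-minimizers of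
  -- the L² norm in them are Cauchy by the parallelogram law, so strong convergence is available
  -- without weak compactness.
  by_contra! H
  set S : ℕ → Set (E → ℝ) := fun n => {f | Measurable f ∧ (∀ x, f x ∈ Set.Icc (0 : ℝ) 1) ∧
    energy J f ≤ ENNReal.ofReal ((1 / 2) ^ n) ∧ ε ≤ ∫ x, φ x * f x ∂π} with hS
  set I : (E → ℝ) → ℝ := fun f => ∫ x, f x ^ 2 ∂π with hI
  have hSne : ∀ n, (S n).Nonempty := fun n => by
    obtain ⟨f, h1, h2, h3, h4⟩ := H ((1 / 2) ^ n) (by positivity)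
    exact ⟨f, h1, h2, h3, h4.le⟩
  have hSanti : ∀ m n, m ≤ n → S n ⊆ S m := fun m n hmn f hf =>
    ⟨hf.1, hf.2.1, hf.2.2.1.trans (ENNReal.ofReal_le_ofReal
      (pow_le_pow_of_le_one (by norm_num) (by norm_num) hmn)), hf.2.2.2⟩
  have hsq : ∀ f : E → ℝ, (∀ x, f x ∈ Set.Icc (0 : ℝ) 1) → ∀ x, |f x ^ 2| ≤ 1 := by
    intro f hf x
    rw [abs_of_nonneg (sq_nonneg _)]
    exact pow_le_one₀ (hf x).1 (hf x).2
  have hI0 : ∀ f, 0 ≤ I f := fun f => integral_nonneg fun x => sq_nonneg _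
  have hI1 : ∀ n, ∀ f ∈ S n, I f ≤ 1 := fun n f hf => by
    have := integral_mono (integrable_of_forall_abs_le (π := π) (hf.1.pow_const 2)
      (hsq f hf.2.1)) (integrable_const 1) (fun x => (le_abs_self _).trans (hsq f hf.2.1 x))
    simpa using this
  have hbdd : ∀ n, BddBelow (I '' S n) := fun n => ⟨0, by rintro _ ⟨f, -, rfl⟩; exact hI0 f⟩
  set a : ℕ → ℝ := fun n => sInf (I '' S n) with ha
  have hale : ∀ n, ∀ f ∈ S n, a n ≤ I f := fun n f hf => csInf_le (hbdd n) ⟨f, hf, rfl⟩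
  have hamono : Monotone a := fun m n hmn =>
    csInf_le_csInf (hbdd m) ((hSne n).image I) (Set.image_mono (hSanti m n hmn))
  have haub : BddAbove (Set.range a) := ⟨1, by
    rintro _ ⟨n, rfl⟩
    obtain ⟨f, hf⟩ := hSne n
    exact (hale n f hf).trans (hI1 n f hf)⟩
  have halim := tendsto_atTop_ciSup hamono haub
  set A := ⨆ n, a n
  have haA : ∀ n, a n ≤ A := fun n => le_ciSup haub n
  have hchoose : ∀ n : ℕ, ∃ f ∈ S n, I f < a n + (1 / 2) ^ n := fun n => by
    obtain ⟨_, ⟨f, hf, rfl⟩, hlt⟩ := exists_lt_of_csInf_lt ((hSne n).image I)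
      (show sInf (I '' S n) < a n + (1 / 2) ^ n by simp [ha])
    exact ⟨f, hf, hlt⟩
  choose f hfS hfI using hchoose
  have hfm : ∀ n, Measurable (f n) := fun n => (hfS n).1
  have hf1 : ∀ n x, f n x ∈ Set.Icc (0 : ℝ) 1 := fun n => (hfS n).2.1
  have hφf : ∀ n, Integrable (fun x => φ x * f n x) π := fun n =>
    integrable_of_forall_abs_le (hφ.mul (hfm n)) (C := 1) fun x => by
      rw [abs_mul]
      exact mul_le_one₀ (hφ1 x) (abs_nonneg _)
        (abs_le.2 ⟨by linarith [(hf1 n x).1], (hf1 n x).2⟩)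
  have hfsq : ∀ n, Integrable (fun x => f n x ^ 2) π := fun n =>
    integrable_of_forall_abs_le ((hfm n).pow_const 2) (hsq _ (hf1 n))
  have hmid : ∀ n m, n ≤ m → (fun x => (f n x + f m x) / 2) ∈ S n := by
    intro n m hnm
    have hm := hSanti n m hnm (hfS m)
    refine ⟨by have := hfm n; have := hfm m; fun_prop, fun x => ?_, ?_, ?_⟩
    · have h1 := hf1 n x
      have h2 := hf1 m x
      exact ⟨by linarith [h1.1, h2.1], by linarith [h1.2, h2.2]⟩
    · refine (energy_le_add_of_forall J (g := f n) (h := f m) (C := 1 / 2) (C' := 1 / 2) (hfm n)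
        (by norm_num) (by norm_num) fun x y => ?_).trans ?_
      · nlinarith [sq_nonneg ((f n y - f n x) - (f m y - f m x))]
      · refine (add_le_add (mul_le_mul_right (hfS n).2.2.1 _)
          (mul_le_mul_right hm.2.2.1 _)).trans (le_of_eq ?_)
        rw [← add_mul, ← ENNReal.ofReal_add (by norm_num) (by norm_num)]
        norm_num
    · have : ∀ x, φ x * ((f n x + f m x) / 2) = (φ x * f n x + φ x * f m x) / 2 := fun x => by ring
      simp_rw [this]
      rw [integral_div, integral_add (hφf n) (hφf m)]
      linarith [(hfS n).2.2.2, (hfS m).2.2.2]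
  -- The midpoint lies in `S n`, so the squared distance is at most `2(a n + 2^{-n}) + 2(a m +
  -- 2^{-m}) - 4 a n`, which `e n` bounds.
  set e : ℕ → ℝ := fun n => 2 * (A - a n) + 4 * (1 / 2) ^ n with he
  have hdist : ∀ n m, n ≤ m → ∫ x, (f n x - f m x) ^ 2 ∂π ≤ e n := by
    intro n m hnm
    have h1 := hale n _ (hmid n m hnm)
    have h2 : ∫ x, (f n x - f m x) ^ 2 ∂π =
        2 * I (f n) + 2 * I (f m) - 4 * I (fun x => (f n x + f m x) / 2) := by
      simp only [hI]
      rw [← integral_const_mul, ← integral_const_mul, ← integral_const_mul, ← integral_add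
        ((hfsq n).const_mul 2) ((hfsq m).const_mul 2), ← integral_sub]
      · refine integral_congr_ae (ae_of_all _ fun x => ?_)
        simp only
        ring
      · exact ((hfsq n).const_mul 2).add ((hfsq m).const_mul 2)
      · exact Integrable.const_mul (integrable_of_forall_abs_le
          ((hmid n m hnm).1.pow_const 2) (hsq _ (hmid n m hnm).2.1)) 4
    have h3 := hfI n
    have h4 := hfI m
    have h5 := haA m
    have h6 : (1 / 2 : ℝ) ^ m ≤ (1 / 2) ^ n := pow_le_pow_of_le_one (by norm_num) (by norm_num) hnm
    rw [h2]
    simp only [he]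
    linarith
  have helim : Tendsto e atTop (𝓝 0) := by
    have h1 : Tendsto (fun n => A - a n) atTop (𝓝 0) := by
      simpa using halim.const_sub A
    have h2 : Tendsto (fun n : ℕ => (1 / 2 : ℝ) ^ n) atTop (𝓝 0) :=
      tendsto_pow_atTop_nhds_zero_of_lt_one (by norm_num) (by norm_num)
    simpa [he] using (h1.const_mul 2).add (h2.const_mul 4)
  -- Along this subsequence the L² distances are geometrically small, giving a.e. convergence; `k ≤
  -- s k` keeps the energies summable.
  obtain ⟨s, hs, hse⟩ := extraction_forall_of_eventually
    (P := fun k n => e n < ((1 / 2) ^ k) ^ 2)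
    (fun k => helim.eventually_lt_const (by positivity))
  have hL2 : ∀ n, MemLp (f n) 2 π := fun n =>
    (memLp_two_iff_integrable_sq (hfm n).aestronglyMeasurable).2 (hfsq n)
  have hae : ∀ᵐ x ∂π, ∃ l, Tendsto (fun n => f (s n) x) atTop (𝓝 l) := by
    refine Lp.ae_tendsto_of_cauchy_eLpNorm (p := 2) (B := fun k => ENNReal.ofReal ((1 / 2) ^ k))
      (fun n => (hfm _).aestronglyMeasurable) (by norm_num) ?_ ?_
    · rw [← ENNReal.ofReal_tsum_of_nonneg (fun n => by positivity) summable_geometric_two]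
      exact ENNReal.ofReal_ne_top
    · have key : ∀ N n m : ℕ, N ≤ n → n ≤ m →
          eLpNorm (f (s n) - f (s m)) 2 π < ENNReal.ofReal ((1 / 2) ^ N) := by
        intro N n m hN hnm
        refine eLpNorm_two_lt_of_integral_sq_lt ((hL2 _).sub (hL2 _)) (by positivity) ?_
        refine (hdist _ _ (hs.monotone hnm)).trans_lt ((hse n).trans_le ?_)
        gcongr ?_ ^ 2
        exact pow_le_pow_of_le_one (by norm_num) (by norm_num) hN
      intro N n m hn hm
      rcases le_total n m with h | h
      · exact key N n m hn h
      · rw [eLpNorm_sub_comm]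
        exact key N m n hm h
  obtain ⟨c, hc⟩ := hirr.exists_tendsto_const (fun n => hfm (s n)) (fun n => hf1 (s n)) (by
    refine ne_top_of_le_ne_top ?_ (ENNReal.tsum_le_tsum fun n => (hfS (s n)).2.2.1.trans
      (ENNReal.ofReal_le_ofReal (pow_le_pow_of_le_one (by norm_num) (by norm_num) (hs.le_apply))))
    rw [← ENNReal.ofReal_tsum_of_nonneg (fun n => by positivity) summable_geometric_two]
    exact ENNReal.ofReal_ne_top) hae
  -- The limit is a constant and `φ` is centred, so the correlations tend to 0 although each is at
  -- least `ε`.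
  have hconv : Tendsto (fun n => ∫ x, φ x * f (s n) x ∂π) atTop (𝓝 (∫ x, φ x * c ∂π)) := by
    refine tendsto_integral_of_dominated_convergence (fun _ => 1)
      (fun n => (hφf _).aestronglyMeasurable) (integrable_const 1) (fun n => ae_of_all _ fun x => ?_)
      ?_
    · rw [Real.norm_eq_abs, abs_mul]
      exact mul_le_one₀ (hφ1 x) (abs_nonneg _)
        (abs_le.2 ⟨by linarith [(hf1 (s n) x).1], (hf1 (s n) x).2⟩)
    · filter_upwards [hc] with x hx
      exact hx.const_mul _
  rw [integral_mul_const, hφ0, zero_mul] at hconv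
  exact absurd (ge_of_tendsto' hconv fun n => (hfS (s n)).2.2.2) (not_le.2 hε)

end Irreducible

/-! ### Poincaré inequality for irreducible forms -/

/-- There is a function with values in `[0, 1]`, of energy at most `δ` and of integral at least `a`,
whose support has a cutoff function of energy at most `δ` and of integral at most `m`. -/
def HasProfile (π : Measure E) (J : Measure (E × E)) (δ a m : ℝ) : Prop :=
  ∃ φ χ : E → ℝ, (Measurable φ ∧ (∀ x, φ x ∈ Set.Icc (0 : ℝ) 1) ∧
      energy J φ ≤ ENNReal.ofReal δ ∧ a ≤ ∫ x, φ x ∂π) ∧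
    (Measurable χ ∧ (∀ x, χ x ∈ Set.Icc (0 : ℝ) 1) ∧
      energy J χ ≤ ENNReal.ofReal δ ∧ ∫ x, χ x ∂π ≤ m) ∧ ∀ x, φ x ≠ 0 → χ x = 1

/-- The product rule for increments of functions bounded by 1 gives `D(fg) ≤ 2 D(f) + 2 D(g)`,
whence the quarters. -/
theorem energy_mul_le {J : Measure (E × E)} {f g : E → ℝ} (hf : Measurable f)
    (hf1 : ∀ x, f x ∈ Set.Icc (0 : ℝ) 1) (hg1 : ∀ x, g x ∈ Set.Icc (0 : ℝ) 1) {δ : ℝ}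
    (hδ : 0 < δ) (hfδ : energy J f ≤ ENNReal.ofReal (δ / 4))
    (hgδ : energy J g ≤ ENNReal.ofReal (δ / 4)) :
    energy J (fun x => f x * g x) ≤ ENNReal.ofReal δ := by
  refine (energy_le_add_of_forall J (g := f) (h := g) (C := 2) (C' := 2) hf
    (by norm_num) (by norm_num) fun x y => ?_).trans ?_
  · have e : f y * g y - f x * g x = g y * (f y - f x) + f x * (g y - g x) := by ring
    have h1 : (g y * (f y - f x)) ^ 2 ≤ (f y - f x) ^ 2 := by
      rw [mul_pow]
      exact mul_le_of_le_one_left (sq_nonneg _) (pow_le_one₀ (hg1 y).1 (hg1 y).2)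
    have h2 : (f x * (g y - g x)) ^ 2 ≤ (g y - g x) ^ 2 := by
      rw [mul_pow]
      exact mul_le_of_le_one_left (sq_nonneg _) (pow_le_one₀ (hf1 x).1 (hf1 x).2)
    rw [e]
    nlinarith [sq_nonneg (g y * (f y - f x) - f x * (g y - g x))]
  · refine (add_le_add (mul_le_mul_right hfδ _) (mul_le_mul_right hgδ _)).trans (le_of_eq ?_)
    rw [← ENNReal.ofReal_mul (by norm_num), ← ENNReal.ofReal_add (by positivity) (by positivity)]
    congr 1
    ring

section Irreducible

variable {π : Measure E} [IsProbabilityMeasure π] {J : Measure (E × E)}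

theorem integrable_of_mem_Icc {f : E → ℝ} (hf : Measurable f)
    (hf1 : ∀ x, f x ∈ Set.Icc (0 : ℝ) 1) : Integrable f π :=
  integrable_of_forall_abs_le hf (C := 1) fun x => abs_le.2 ⟨by linarith [(hf1 x).1], (hf1 x).2⟩

theorem integral_mem_Icc {f : E → ℝ} (hf : Measurable f) (hf1 : ∀ x, f x ∈ Set.Icc (0 : ℝ) 1) :
    ∫ x, f x ∂π ∈ Set.Icc (0 : ℝ) 1 := by
  refine ⟨integral_nonneg fun x => (hf1 x).1, ?_⟩
  have := integral_mono (integrable_of_mem_Icc (π := π) hf hf1) (integrable_const 1)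
    fun x => (hf1 x).2
  simpa using this

/-- The one-sided estimate is applied to `b - π(b)` and to its negative. -/
theorem Irreducible.exists_abs_integral_mul_sub_le (hirr : Irreducible π J) {b : E → ℝ}
    (hb : Measurable b) (hb1 : ∀ x, b x ∈ Set.Icc (0 : ℝ) 1) {ε : ℝ} (hε : 0 < ε) :
    ∃ δ : ℝ, 0 < δ ∧ ∀ f : E → ℝ, Measurable f → (∀ x, f x ∈ Set.Icc (0 : ℝ) 1) →
      energy J f ≤ ENNReal.ofReal δ →
      |∫ x, b x * f x ∂π - (∫ x, b x ∂π) * ∫ x, f x ∂π| ≤ ε := by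
  have hbi := integrable_of_mem_Icc (π := π) hb hb1
  have hm := integral_mem_Icc (π := π) hb hb1
  set m := ∫ x, b x ∂π
  have hbd : ∀ x, |b x - m| ≤ 1 := fun x =>
    abs_le.2 ⟨by linarith [(hb1 x).1, hm.2], by linarith [(hb1 x).2, hm.1]⟩
  have h0 : ∫ x, (b x - m) ∂π = 0 := by
    rw [integral_sub hbi (integrable_const _)]
    simp [m]
  obtain ⟨δ₁, h1, H1⟩ := hirr.exists_forall_integral_mul_le (hb.sub_const m) hbd h0 hε
  obtain ⟨δ₂, h2, H2⟩ := hirr.exists_forall_integral_mul_le (φ := fun x => m - b x)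
    (hb.const_sub m) (fun x => by rw [abs_sub_comm]; exact hbd x)
    (by rw [← neg_eq_zero, ← integral_neg]; simpa using h0) hε
  refine ⟨min δ₁ δ₂, lt_min h1 h2, fun f hf hf1 hfe => ?_⟩
  have hfi := integrable_of_mem_Icc (π := π) hf hf1
  have hbf : Integrable (fun x => b x * f x) π := integrable_of_mem_Icc (hb.mul hf) fun x =>
    ⟨mul_nonneg (hb1 x).1 (hf1 x).1, mul_le_one₀ (hb1 x).2 (hf1 x).1 (hf1 x).2⟩
  have H1' := H1 f hf hf1 (hfe.trans (ENNReal.ofReal_le_ofReal (min_le_left _ _)))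
  have H2' := H2 f hf hf1 (hfe.trans (ENNReal.ofReal_le_ofReal (min_le_right _ _)))
  simp_rw [sub_mul] at H1' H2'
  rw [integral_sub hbf (hfi.const_mul m), integral_const_mul] at H1'
  rw [integral_sub (hfi.const_mul m) hbf, integral_const_mul] at H2'
  exact abs_le.2 ⟨by linarith, by linarith⟩

/-- A profile is multiplied by a fresh one whose energy is chosen after the first is fixed. They are
then nearly uncorrelated and integrals multiply up to an error; `η / 2` and `3 / 4` in place of `η`
and `1 / 2` leave room for it. -/
theorem Irreducible.hasProfile_pow (hirr : Irreducible π J) {η : ℝ} (hη : 0 < η)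
    (H : ∀ δ, 0 < δ → HasProfile π J δ η (1 / 2)) (k : ℕ) :
    ∀ δ, 0 < δ → HasProfile π J δ ((η / 2) ^ k) ((3 / 4) ^ k) := by
  induction k with
  | zero =>
    intro δ hδ
    refine ⟨fun _ => 1, fun _ => 1, ?_, ?_, fun x _ => rfl⟩ <;>
      exact ⟨measurable_const, by simp, by simp [energy], by simp⟩
  | succ k ih =>
    intro δ hδ
    obtain ⟨b, θ, ⟨hb, hb1, hbe, hbi⟩, ⟨hθ, hθ1, hθe, hθi⟩, hbθ⟩ := ih (δ / 4) (by positivity)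
    obtain ⟨δ₁, hδ₁, H1⟩ := hirr.exists_abs_integral_mul_sub_le hb hb1
      (ε := (η / 2) ^ (k + 1)) (by positivity)
    obtain ⟨δ₂, hδ₂, H2⟩ := hirr.exists_abs_integral_mul_sub_le hθ hθ1
      (ε := 1 / 4 * (3 / 4) ^ k) (by positivity)
    obtain ⟨φ, χ, ⟨hφ, hφ1, hφe, hφi⟩, ⟨hχ, hχ1, hχe, hχi⟩, hφχ⟩ :=
      H (min (δ / 4) (min δ₁ δ₂)) (by positivity)
    have l0 : ENNReal.ofReal (min (δ / 4) (min δ₁ δ₂)) ≤ ENNReal.ofReal (δ / 4) :=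
      ENNReal.ofReal_le_ofReal (min_le_left _ _)
    have l1 : ENNReal.ofReal (min (δ / 4) (min δ₁ δ₂)) ≤ ENNReal.ofReal δ₁ :=
      ENNReal.ofReal_le_ofReal ((min_le_right _ _).trans (min_le_left _ _))
    have l2 : ENNReal.ofReal (min (δ / 4) (min δ₁ δ₂)) ≤ ENNReal.ofReal δ₂ :=
      ENNReal.ofReal_le_ofReal ((min_le_right _ _).trans (min_le_right _ _))
    refine ⟨fun x => b x * φ x, fun x => θ x * χ x,
      ⟨hb.mul hφ, fun x => ⟨mul_nonneg (hb1 x).1 (hφ1 x).1,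
        mul_le_one₀ (hb1 x).2 (hφ1 x).1 (hφ1 x).2⟩,
        energy_mul_le hb hb1 hφ1 hδ hbe (hφe.trans l0), ?_⟩,
      ⟨hθ.mul hχ, fun x => ⟨mul_nonneg (hθ1 x).1 (hχ1 x).1,
        mul_le_one₀ (hθ1 x).2 (hχ1 x).1 (hχ1 x).2⟩,
        energy_mul_le hθ hθ1 hχ1 hδ hθe (hχe.trans l0), ?_⟩, fun x hx => ?_⟩
    · have h1 := (abs_le.1 (H1 φ hφ hφ1 (hφe.trans l1))).1
      have h2 : (η / 2) ^ k * η ≤ (∫ x, b x ∂π) * ∫ x, φ x ∂π := by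
        have := (integral_mem_Icc (π := π) hb hb1).1
        gcongr
      have h3 : (η / 2) ^ k * η = 2 * (η / 2) ^ (k + 1) := by ring
      linarith
    · have h1 := (abs_le.1 (H2 χ hχ hχ1 (hχe.trans l2))).2
      have h2 : (∫ x, θ x ∂π) * ∫ x, χ x ∂π ≤ (3 / 4) ^ k * (1 / 2) := by
        have := (integral_mem_Icc (π := π) hχ hχ1).1
        gcongr
      rw [pow_succ]
      linarith
    · change θ x * χ x = 1
      rw [hbθ x (left_ne_zero_of_mul hx), hφχ x (right_ne_zero_of_mul hx), mul_one]

/-- Profiles are incompatible with a Faber-Krahn type inequality. -/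
theorem Irreducible.not_forall_hasProfile (hirr : Irreducible π J) {s C η : ℝ} (hs : 0 < s)
    (hC : 0 < C) (hη : 0 < η)
    (FK : ∀ g : E → ℝ, Measurable g → (∀ x, 0 ≤ g x) → MemLp g 2 π →
      π {x | 0 < g x} ≤ ENNReal.ofReal s →
      ∫⁻ x, ENNReal.ofReal (g x ^ 2) ∂π ≤ ENNReal.ofReal C * energy J g) :
    ¬ ∀ δ, 0 < δ → HasProfile π J δ η (1 / 2) := by
  intro H
  obtain ⟨k, hk⟩ := exists_pow_lt_of_lt_one hs (show (3 / 4 : ℝ) < 1 by norm_num)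
  set a := (η / 2) ^ k with ha
  have ha0 : 0 < a := by positivity
  -- The power `k` is fixed by `s` before the energy is chosen. Faber-Krahn will give `∫ b² ≤ a² /
  -- 2`, whereas `∫ b ≥ a` forces `∫ b² ≥ a²`.
  obtain ⟨b, χ, ⟨hb, hb1, hbe, hbi⟩, ⟨hχ, hχ1, hχe, hχi⟩, hbχ⟩ :=
    hirr.hasProfile_pow hη H k (a ^ 2 / (2 * C)) (by positivity)
  have hbint := integrable_of_mem_Icc (π := π) hb hb1
  have hsqint : Integrable (fun x => b x ^ 2) π := integrable_of_mem_Icc (hb.pow_const 2)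
    fun x => ⟨sq_nonneg _, pow_le_one₀ (hb1 x).1 (hb1 x).2⟩
  have hsupp : π {x | 0 < b x} ≤ ENNReal.ofReal s := by
    have h1 := meas_le_lintegral₀ (μ := π) (f := fun x => ENNReal.ofReal (χ x))
      (s := {x | 0 < b x}) (by fun_prop) fun x (hx : 0 < b x) => by simp [hbχ x hx.ne']
    rw [← ofReal_integral_eq_lintegral_ofReal (integrable_of_mem_Icc hχ hχ1)
      (ae_of_all _ fun x => (hχ1 x).1)] at h1
    exact h1.trans (ENNReal.ofReal_le_ofReal (hχi.trans hk.le))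
  have h1 := (FK b hb (fun x => (hb1 x).1)
    ((memLp_two_iff_integrable_sq hb.aestronglyMeasurable).2 hsqint) hsupp).trans
    (mul_le_mul_right hbe _)
  rw [← ofReal_integral_eq_lintegral_ofReal hsqint (ae_of_all _ fun x => sq_nonneg _),
    ← ENNReal.ofReal_mul hC.le, ENNReal.ofReal_le_ofReal_iff (by positivity),
    show C * (a ^ 2 / (2 * C)) = a ^ 2 / 2 by field_simp] at h1
  have h2 : ∫ x, (2 * a * b x - a ^ 2) ∂π ≤ ∫ x, b x ^ 2 ∂π :=
    integral_mono ((hbint.const_mul _).sub (integrable_const _)) hsqint fun x => by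
      simp only
      nlinarith [sq_nonneg (b x - a)]
  rw [integral_sub (hbint.const_mul _) (integrable_const _), integral_const_mul] at h2
  simp only [integral_const, probReal_univ, one_smul] at h2
  nlinarith

/-- A normalized function of small energy and with half of its mass at zero gives a profile. -/
theorem hasProfile_of_energy_le {s C L δ δ' : ℝ} (hC : 0 < C) (hL : 1 ≤ L)
    (hLs : 1 / L ^ 2 ≤ s)
    (FK : ∀ g : E → ℝ, Measurable g → (∀ x, 0 ≤ g x) → MemLp g 2 π →
      π {x | 0 < g x} ≤ ENNReal.ofReal s →
      ∫⁻ x, ENNReal.ofReal (g x ^ 2) ∂π ≤ ENNReal.ofReal C * energy J g)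
    (hδ' : δ' ≤ 1 / (4 * C)) (hδδ' : δ' ≤ δ * (1 / (8 * L ^ 2)) ^ 2) (hδ : 0 < δ)
    {g : E → ℝ} (hg : Measurable g) (hg0 : ∀ x, 0 ≤ g x) (hg2 : MemLp g 2 π)
    (hsupp : π {x | 0 < g x} ≤ 1 / 2) (hnormg : ∫ x, g x ^ 2 ∂π = 1)
    (hen : energy J g ≤ ENNReal.ofReal δ') :
    HasProfile π J δ (1 / (8 * L ^ 2)) (1 / 2) := by
  have hL0 : 0 < L := by linarith
  set η := 1 / (8 * L ^ 2) with hη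
  have hη0 : 0 < η := by positivity
  have hη1 : η ≤ 1 := by
    rw [hη, div_le_one (by positivity)]
    nlinarith
  have hmax : ∀ a b : ℝ, (max a 0 - max b 0) ^ 2 ≤ (a - b) ^ 2 := fun a b =>
    sq_le_sq.2 (by simpa using abs_max_sub_max_le_abs a b 0)
  have hmin : ∀ a b l : ℝ, (min a l - min b l) ^ 2 ≤ (a - b) ^ 2 := fun a b l =>
    sq_le_sq.2 (by simpa using abs_min_sub_min_le_max a l b l)
  -- Chebyshev bounds the support by `1 / L² ≤ s`, so Faber-Krahn applies to the part above `L`: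
  -- little of the L² mass lies there.
  have hupper : ∫ x, max (g x - L) 0 ^ 2 ∂π ≤ 1 / 4 := by
    have hup2 : MemLp (fun x => max (g x - L) 0) 2 π := by
      refine hg2.mono (by fun_prop) (ae_of_all _ fun x => ?_)
      rw [Real.norm_eq_abs, Real.norm_eq_abs, abs_of_nonneg (le_max_right _ _),
        abs_of_nonneg (hg0 x)]
      exact max_le (by linarith) (hg0 x)
    have hsm : π {x | 0 < max (g x - L) 0} ≤ ENNReal.ofReal s := by
      have h1 := meas_le_lintegral₀ (μ := π) (f := fun x => ENNReal.ofReal (g x ^ 2 / L ^ 2))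
        (s := {x | 0 < max (g x - L) 0}) (by fun_prop) fun x hx => by
          have hx : L < g x := by simpa using hx
          rw [← ENNReal.ofReal_one]
          refine ENNReal.ofReal_le_ofReal ((one_le_div (by positivity)).2 ?_)
          gcongr
      rw [← ofReal_integral_eq_lintegral_ofReal (hg2.integrable_sq.div_const _)
        (ae_of_all _ fun x => by positivity), integral_div, hnormg] at h1
      exact h1.trans (ENNReal.ofReal_le_ofReal hLs)
    have h2 := (FK _ (by fun_prop) (fun x => le_max_right _ _) hup2 hsm).trans
      (mul_le_mul_right ((energy_mono_of_forall J (g := g) fun x y =>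
        (hmax _ _).trans (by simp)).trans hen) _)
    rw [← ofReal_integral_eq_lintegral_ofReal hup2.integrable_sq
      (ae_of_all _ fun x => sq_nonneg _), ← ENNReal.ofReal_mul hC.le] at h2
    have h3 : C * δ' ≤ 1 / 4 := by
      calc C * δ' ≤ C * (1 / (4 * C)) := by gcongr
        _ = 1 / 4 := by field_simp
    exact (ENNReal.ofReal_le_ofReal_iff (by norm_num)).1 (h2.trans (ENNReal.ofReal_le_ofReal h3))
  set c : E → ℝ := fun x => min (g x) L / L with hc
  have hcm : Measurable c := by fun_prop
  have hc1 : ∀ x, c x ∈ Set.Icc (0 : ℝ) 1 := fun x =>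
    ⟨div_nonneg (le_min (hg0 x) hL0.le) hL0.le, (div_le_one hL0).2 (min_le_right _ _)⟩
  have hcg : ∀ x y, (c y - c x) ^ 2 ≤ (g y - g x) ^ 2 := fun x y => by
    simp only [hc]
    rw [← sub_div, div_pow]
    exact (div_le_self (sq_nonneg _) (by nlinarith)).trans (hmin _ _ _)
  have hci := integrable_of_mem_Icc (π := π) hcm hc1
  have hcint : 2 * η ≤ ∫ x, c x ∂π := by
    -- Integrated, this reads `1 ≤ 2 L² ∫ c + 1/2`, that is `∫ c ≥ 1 / (4 L²) = 2η`.
    have hpt : ∀ x, g x ^ 2 ≤ 2 * L ^ 2 * c x + 2 * max (g x - L) 0 ^ 2 := fun x => by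
      have e : L ^ 2 * c x = L * min (g x) L := by simp only [hc]; field_simp
      rw [mul_assoc, e]
      have := hg0 x
      rcases le_total (g x) L with h | h
      · rw [min_eq_left h, max_eq_right (by linarith)]
        nlinarith
      · rw [min_eq_right h, max_eq_left (by linarith)]
        nlinarith [sq_nonneg (g x - 2 * L)]
    have hup2i : Integrable (fun x => max (g x - L) 0 ^ 2) π := by
      refine hg2.integrable_sq.mono (by fun_prop) (ae_of_all _ fun x => ?_)
      rw [Real.norm_eq_abs, Real.norm_eq_abs, abs_of_nonneg (sq_nonneg _),
        abs_of_nonneg (sq_nonneg _)]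
      have := hg0 x
      gcongr
      exact max_le (by linarith) this
    have h1 := integral_mono hg2.integrable_sq ((hci.const_mul _).add (hup2i.const_mul 2)) hpt
    simp only [Pi.add_apply] at h1
    rw [hnormg, integral_add (hci.const_mul _) (hup2i.const_mul 2), integral_const_mul,
      integral_const_mul] at h1
    have h2 : 1 / 2 ≤ 2 * L ^ 2 * ∫ x, c x ∂π := by linarith
    have h3 : 2 * η = 1 / 2 / (2 * L ^ 2) := by rw [hη]; field_simp; norm_num
    rw [h3, div_le_iff₀ (by positivity)]
    linarith
  have hδη : δ' ≤ δ := hδδ'.trans (mul_le_of_le_one_right hδ.le (pow_le_one₀ hη0.le hη1))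
  have hχ1 : ∀ x, min (c x / η) 1 ∈ Set.Icc (0 : ℝ) 1 := fun x =>
    ⟨le_min (div_nonneg (hc1 x).1 hη0.le) zero_le_one, min_le_right _ _⟩
  -- Lowering `c` by `η` keeps half of the guaranteed integral `2η` and makes room for a cutoff. The
  -- cutoff vanishes with `g` and costs a factor `1 / η²` in energy, hence the bound `δ' ≤ δ η²`.
  refine ⟨fun x => max (c x - η) 0, fun x => min (c x / η) 1,
    ⟨by fun_prop, fun x => ⟨le_max_right _ _, max_le (by linarith [(hc1 x).2]) zero_le_one⟩,
      ?_, ?_⟩, ⟨by fun_prop, hχ1, ?_, ?_⟩, fun x hx => ?_⟩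
  · refine (energy_mono_of_forall J (g := g) fun x y => ?_).trans
      (hen.trans (ENNReal.ofReal_le_ofReal hδη))
    exact (hmax _ _).trans (by simpa using hcg x y)
  · have h1 : ∫ x, (c x - η) ∂π ≤ ∫ x, max (c x - η) 0 ∂π :=
      integral_mono (hci.sub (integrable_const _))
        ((hci.sub (integrable_const _)).sup (integrable_const 0)) fun x => le_max_left _ _
    rw [integral_sub hci (integrable_const _)] at h1
    simp only [integral_const, probReal_univ, one_smul] at h1
    linarith
  · refine (energy_le_of_forall J (g := g) (C := 1 / η ^ 2) (by positivity) fun x y => ?_).trans ?_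
    · refine (hmin _ _ _).trans ?_
      rw [← sub_div, div_pow, div_eq_inv_mul, one_div]
      exact mul_le_mul_of_nonneg_left (hcg x y) (by positivity)
    · refine (mul_le_mul_right hen _).trans ?_
      rw [← ENNReal.ofReal_mul (by positivity)]
      refine ENNReal.ofReal_le_ofReal ?_
      rw [one_div, inv_mul_le_iff₀ (by positivity)]
      linarith
  · have hle : ∫⁻ x, ENNReal.ofReal (min (c x / η) 1) ∂π ≤ ENNReal.ofReal (1 / 2) := by
      calc _ ≤ ∫⁻ x, {x | 0 < g x}.indicator (fun _ => 1) x ∂π := by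
            refine lintegral_mono fun x => ?_
            rw [Set.indicator_apply]
            split_ifs with hx
            · simp
            · have hx0 : g x = 0 := le_antisymm (not_lt.1 hx) (hg0 x)
              simp [hc, hx0, hL0.le]
        _ = π {x | 0 < g x} := by
            rw [lintegral_indicator_const (measurableSet_lt measurable_const hg), one_mul]
        _ ≤ _ := by
            refine hsupp.trans (le_of_eq ?_)
            rw [one_div, one_div, ENNReal.ofReal_inv_of_pos (by norm_num)]
            simp
    rw [← ofReal_integral_eq_lintegral_ofReal (integrable_of_mem_Icc (by fun_prop) hχ1)
      (ae_of_all _ fun x => (hχ1 x).1)] at hle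
    exact (ENNReal.ofReal_le_ofReal_iff (by norm_num)).1 hle
  · have : η < c x := by
      by_contra hle
      exact hx (max_eq_right (by linarith))
    exact min_eq_right ((one_le_div hη0).2 this.le)

/-- An irreducible form which satisfies a Faber-Krahn type inequality for functions with small
support satisfies a Poincaré inequality. -/
theorem Irreducible.poincareInequality (hirr : Irreducible π J) {s C : ℝ} (hs : 0 < s)
    (hC : 0 < C)
    (FK : ∀ g : E → ℝ, Measurable g → (∀ x, 0 ≤ g x) → MemLp g 2 π →
      π {x | 0 < g x} ≤ ENNReal.ofReal s →
      ∫⁻ x, ENNReal.ofReal (g x ^ 2) ∂π ≤ ENNReal.ofReal C * energy J g) :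
    PoincareInequality π J := by
  by_contra hP
  obtain ⟨L, hL, hLs⟩ : ∃ L : ℝ, 1 ≤ L ∧ 1 / L ^ 2 ≤ s := by
    refine ⟨1 + 1 / s, by simp; positivity, ?_⟩
    rw [div_le_iff₀ (by positivity)]
    have : s * (1 + 1 / s) ^ 2 = s + 2 + 1 / s := by field_simp; ring
    have : 0 < 1 / s := by positivity
    linarith
  have hL0 : 0 < L := by linarith
  refine hirr.not_forall_hasProfile hs hC (η := 1 / (8 * L ^ 2)) (by positivity) FK
    fun δ hδ => ?_
  -- A function violating Poincaré with constant `1 / δ'` has energy below `δ'` after normalization.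
  set δ' := min (1 / (4 * C)) (δ * (1 / (8 * L ^ 2)) ^ 2) with hδ'
  have hδ'0 : 0 < δ' := by positivity
  have hex : ∃ g : E → ℝ, Measurable g ∧ (∀ x, 0 ≤ g x) ∧ MemLp g 2 π ∧
      π {x | 0 < g x} ≤ 1 / 2 ∧
      ENNReal.ofReal (1 / δ') * energy J g < ∫⁻ x, ENNReal.ofReal (g x ^ 2) ∂π := by
    by_contra! hno
    exact hP (poincareInequality_of_forall_nonneg (C := 1 / δ') (by positivity) hno)
  obtain ⟨g, hg, hg0, hg2, hsupp, hlt⟩ := hex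
  have hQ : ∫⁻ x, ENNReal.ofReal (g x ^ 2) ∂π = ENNReal.ofReal (∫ x, g x ^ 2 ∂π) :=
    (ofReal_integral_eq_lintegral_ofReal hg2.integrable_sq
      (ae_of_all _ fun x => sq_nonneg _)).symm
  rw [hQ] at hlt
  set Q := ∫ x, g x ^ 2 ∂π
  have hQ0 : 0 < Q := ENNReal.ofReal_pos.1 (pos_of_gt hlt)
  have hsq : √Q ^ 2 = Q := Real.sq_sqrt hQ0.le
  have hsq0 : 0 < √Q := Real.sqrt_pos.2 hQ0
  refine hasProfile_of_energy_le (δ' := δ') hC hL hLs FK (min_le_left _ _) (min_le_right _ _) hδ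
    (g := fun x => g x / √Q) (by fun_prop) (fun x => div_nonneg (hg0 x) hsq0.le)
    (by simpa [div_eq_mul_inv] using hg2.mul_const (√Q)⁻¹) ?_ ?_ ?_
  · simpa [div_pos_iff_of_pos_right hsq0] using hsupp
  · simp_rw [div_pow, hsq]
    rw [integral_div]
    exact div_self hQ0.ne'
  · refine (energy_le_of_forall J (g := g) (C := 1 / Q) (by positivity) fun x y => ?_).trans ?_
    · rw [← sub_div, div_pow, hsq, div_eq_inv_mul, one_div]
    · calc ENNReal.ofReal (1 / Q) * energy J g
          = ENNReal.ofReal (δ' / Q) * (ENNReal.ofReal (1 / δ') * energy J g) := by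
            rw [← mul_assoc, ← ENNReal.ofReal_mul (by positivity)]
            congr 2
            field_simp
        _ ≤ ENNReal.ofReal (δ' / Q) * ENNReal.ofReal Q := by gcongr
        _ = ENNReal.ofReal δ' := by
            rw [← ENNReal.ofReal_mul (by positivity), div_mul_cancel₀ _ hQ0.ne']

end Irreducible

/-! ### Logarithmic Sobolev inequality -/

/-- The isoperimetric inequality of logarithmic type for sets of measure at most `s`. -/
def LogIsoperimetric (π : Measure E) (K : Measure (E × E)) (s k : ℝ) : Prop :=
  ∀ A : Set E, MeasurableSet A → 0 < π A → π A ≤ ENNReal.ofReal s →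
    ENNReal.ofReal (k * (π.real A * √(Real.log (Real.exp 1 + (π.real A)⁻¹)))) ≤ K (A ×ˢ Aᶜ)

/-! ### Reduction of both logarithmic constants to isoperimetry of small sets -/

section Constants

variable {π : Measure E} {K : Measure (E × E)}

theorem exists_logIsoperimetric_of_constSmall_pos (h : 0 < logSobolevConstSmall π K) :
    ∃ s k : ℝ, 0 < s ∧ 0 < k ∧ LogIsoperimetric π K s k := by
  have hev := (tendsto_logSobolevInfSmall π K).eventually_const_lt h
  obtain ⟨s, hs, hpos⟩ := (hev.and self_mem_nhdsWithin).exists.imp fun s hs => And.symm hs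
  obtain ⟨k, hk, hkle⟩ := exists_ofReal_le_of_pos hpos
  refine ⟨s, k, hs, hk, fun A hA h0 h1 => ?_⟩
  rw [ENNReal.ofReal_mul hk.le]
  refine ENNReal.mul_le_of_le_div (hkle.trans ?_)
  unfold logSobolevInfSmall
  exact iInf₂_le_of_le A hA (iInf₂_le_of_le h0 h1 le_rfl)

theorem exists_logIsoperimetric_of_constShift_pos [IsProbabilityMeasure π]
    (h : 0 < logSobolevConstShift π K) :
    ∃ s k : ℝ, 0 < s ∧ 0 < k ∧ LogIsoperimetric π K s k := by
  have hev := (tendsto_logSobolevInfShift π K).eventually_const_lt h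
  obtain ⟨δ, hpos, hδ⟩ := (hev.and (eventually_ge_atTop 0)).exists
  obtain ⟨k, hk, hkle⟩ := exists_ofReal_le_of_pos hpos
  -- The exponential bound on `u = π(A)` gives `δ ≤ (k / 2) √(1 - log u)`, so half of the main term
  -- absorbs the shift. The bound `u ≤ 1/2` gives `e + 1/u ≤ e/u`.
  refine ⟨min (1 / 2) (Real.exp (-(2 * δ / k) ^ 2)), k / 2, by positivity, by positivity,
    fun A hA h0 h1 => ?_⟩
  have h2 : ENNReal.ofReal k * ENNReal.ofReal (π.real A * √(1 - Real.log (π.real A))) ≤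
      K (A ×ˢ Aᶜ) + ENNReal.ofReal δ * π A := by
    refine ENNReal.mul_le_of_le_div (hkle.trans ?_)
    unfold logSobolevInfShift
    exact iInf₂_le_of_le A hA (iInf_le_of_le h0 le_rfl)
  have hu : π A = ENNReal.ofReal (π.real A) := by simp
  have hu0 : 0 < π.real A := ENNReal.toReal_pos h0.ne' (by simp)
  rw [hu] at h1 h2
  set u := π.real A
  rw [ENNReal.ofReal_le_ofReal_iff (by positivity)] at h1
  rw [← ENNReal.ofReal_mul hk.le, ← ENNReal.ofReal_mul hδ, ← tsub_le_iff_right,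
    ← ENNReal.ofReal_sub _ (by positivity)] at h2
  refine le_trans (ENNReal.ofReal_le_ofReal ?_) h2
  have hu2 : u ≤ 1 / 2 := h1.trans (min_le_left _ _)
  have hlog : (2 * δ / k) ^ 2 ≤ 1 - Real.log u := by
    have h3 := Real.log_le_log hu0 (h1.trans (min_le_right _ _))
    rw [Real.log_exp] at h3
    linarith
  have hsq : 2 * δ / k ≤ √(1 - Real.log u) := Real.le_sqrt_of_sq_le hlog
  have hle : √(Real.log (Real.exp 1 + u⁻¹)) ≤ √(1 - Real.log u) := by
    refine Real.sqrt_le_sqrt ?_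
    rw [show 1 - Real.log u = Real.log (Real.exp 1 / u) by
      rw [Real.log_div (Real.exp_ne_zero _) hu0.ne', Real.log_exp]]
    refine Real.log_le_log (by positivity) ?_
    rw [le_div_iff₀ hu0, add_mul, inv_mul_cancel₀ hu0.ne']
    nlinarith [Real.add_one_le_exp 1]
  have h4 : 2 * δ ≤ √(1 - Real.log u) * k := by rwa [div_le_iff₀ hk] at hsq
  calc k / 2 * (u * √(Real.log (Real.exp 1 + u⁻¹)))
      ≤ k / 2 * (u * √(1 - Real.log u)) := by gcongr
    _ ≤ k * (u * √(1 - Real.log u)) - δ * u := by nlinarith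

end Constants

theorem measure_lt_le_of_lintegral_sq_le_one {π : Measure E} {h : E → ℝ} (hh : Measurable h)
    (h1 : ∫⁻ x, ENNReal.ofReal (h x ^ 2) ∂π ≤ 1) {t : ℝ} (ht : 0 < t) :
    π {x | t < h x} ≤ ENNReal.ofReal (1 / t ^ 2) := by
  have hM := mul_meas_ge_le_lintegral (μ := π) (f := fun x => ENNReal.ofReal (h x ^ 2))
    (by fun_prop) (ENNReal.ofReal (t ^ 2))
  have hsub : π {x | t < h x} ≤ π {x | ENNReal.ofReal (t ^ 2) ≤ ENNReal.ofReal (h x ^ 2)} :=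
    measure_mono fun x (hx : t < h x) => ENNReal.ofReal_le_ofReal (by gcongr)
  rw [ENNReal.ofReal_div_of_pos (by positivity), ENNReal.ofReal_one]
  rw [ENNReal.le_div_iff_mul_le (Or.inl (by simp; positivity)) (Or.inl (by simp)), mul_comm]
  exact (mul_le_mul_right hsub _).trans (hM.trans h1)

/-! ### Faber-Krahn and defective logarithmic inequalities -/

section Defective

variable {π : Measure E} [IsProbabilityMeasure π] {J : Measure (E × E)} {r : E × E → ℝ≥0}

/-- The Faber-Krahn type inequality for functions with small support. -/
theorem LogIsoperimetric.lintegral_sq_le {s k : ℝ}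
    (hiso : LogIsoperimetric π (modified J r (1 / 2)) s k) (hk : 0 < k)
    (hr : Measurable r) (hnorm : (modified J r 1).fst ≤ π)
    {g : E → ℝ} (hg : Measurable g) (hg0 : ∀ x, 0 ≤ g x) (hg2 : MemLp g 2 π)
    (hsupp : π {x | 0 < g x} ≤ ENNReal.ofReal s) :
    ∫⁻ x, ENNReal.ofReal (g x ^ 2) ∂π ≤ ENNReal.ofReal (32 / k ^ 2) * energy J g := by
  refine lintegral_sq_le_of_isoperimetric hr hnorm hg hg0 hg2 hk fun t ht => ?_
  rcases eq_or_ne (π {x | t < g x}) 0 with h0 | h0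
  · simp [h0]
  refine le_trans ?_ (hiso _ (measurableSet_lt measurable_const hg) (pos_iff_ne_zero.2 h0)
    ((measure_mono fun x (hx : t < g x) => ht.trans hx).trans hsupp))
  have hu : π {x | t < g x} = ENNReal.ofReal (π.real {x | t < g x}) := by simp
  have hu0 : 0 < π.real {x | t < g x} := ENNReal.toReal_pos h0 (by simp)
  rw [hu]
  set u := π.real {x | t < g x}
  rw [← ENNReal.ofReal_mul hk.le]
  refine ENNReal.ofReal_le_ofReal ?_
  gcongr
  refine le_mul_of_one_le_right hu0.le (Real.one_le_sqrt.2 ?_)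
  rw [Real.le_log_iff_exp_le (by positivity)]
  have : 0 < u⁻¹ := by positivity
  linarith

/-- For `t ≥ 4` one has `t ≤ (t / 2)²`. This undoes the halved argument in Cheeger's method. -/
theorem sq_mul_log_le_of_four_le {t : ℝ} (ht : 4 ≤ t) :
    t ^ 2 * Real.log t ≤ 8 * ((t / 2) ^ 2 * Real.log (t / 2)) := by
  have h1 : Real.log t ≤ 2 * Real.log (t / 2) := by
    rw [← Real.log_rpow (by positivity)]
    refine Real.log_le_log (by positivity) ?_
    rw [Real.rpow_ofNat]
    nlinarith
  nlinarith [sq_nonneg t]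

/-- The defective inequality for bounded normalized functions. -/
theorem LogIsoperimetric.lintegral_sq_mul_log_le_of_bounded {s k L : ℝ}
    (hiso : LogIsoperimetric π (modified J r (1 / 2)) s k) (hk : 0 < k) (hL : 2 ≤ L)
    (hLs : 1 / L ^ 2 ≤ s) (hr : Measurable r) (hnorm : (modified J r 1).fst ≤ π)
    {h : E → ℝ} (hh : Measurable h) (hh0 : ∀ x, 0 ≤ h x) {N : ℝ} (hN : ∀ x, h x ≤ N)
    (h1 : ∫⁻ x, ENNReal.ofReal (h x ^ 2) ∂π ≤ 1) :
    ∫⁻ x, ENNReal.ofReal (h x ^ 2 * Real.log (max (h x) 1)) ∂π ≤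
      ENNReal.ofReal (128 / k ^ 2) * energy J h +
        ENNReal.ofReal (2 * Real.log (2 * L) + Real.log L) := by
  have hL0 : 0 < L := by linarith
  have hlogL : 0 ≤ Real.log L := Real.log_nonneg (by linarith)
  have hlog2L : 0 ≤ Real.log (2 * L) := Real.log_nonneg (by linarith)
  have hl0 : ∀ t : ℝ, 0 ≤ Real.log (max t 1) := fun t => Real.log_nonneg (le_max_right _ _)
  have hlm : ∀ a b : ℝ, a ≤ b → Real.log (max a 1) ≤ Real.log (max b 1) := fun a b hab =>
    Real.log_le_log (by positivity) (by gcongr)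
  -- Both `w(t)²` and `t w(t) κ(t)` are multiples of `t² log t` above `L`. The cut at `L` restricts
  -- to level sets of measure at most `1 / L² ≤ s`.
  set w : ℝ → ℝ≥0∞ := fun t =>
    if L < t then ENNReal.ofReal (t * √(Real.log (max t 1))) else 0 with hw
  set κ : ℝ → ℝ≥0∞ := fun t => ENNReal.ofReal (k * √(Real.log (max t 1))) with hκ
  have hwm : Monotone w := by
    intro a b hab
    simp only [hw]
    split_ifs with ha hb
    · have : 0 ≤ a := by linarith
      have : 0 ≤ b := by linarith
      have := hlm a b hab
      exact ENNReal.ofReal_le_ofReal (by gcongr)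
    · exact absurd (ha.trans_le hab) hb
    · exact zero_le
    · exact zero_le
  have hκm : Monotone κ := fun a b hab => by
    have := hlm a b hab
    exact ENNReal.ofReal_le_ofReal (by gcongr)
  have hmain := sq_lintegral_le_of_isoperimetric hr hnorm hh hwm hκm (fun t ht => by
    have htL : L < t := by
      by_contra hle
      simp [hw, hle] at ht
    have ht0 : 0 < t := by linarith
    rcases eq_or_ne (π {x | t < h x}) 0 with h0 | h0
    · simp [h0]
    have hmeas := measure_lt_le_of_lintegral_sq_le_one hh h1 ht0
    refine le_trans ?_ (hiso _ (measurableSet_lt measurable_const hh) (pos_iff_ne_zero.2 h0)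
      (hmeas.trans (ENNReal.ofReal_le_ofReal (le_trans (by gcongr) hLs))))
    have hu : π {x | t < h x} = ENNReal.ofReal (π.real {x | t < h x}) := by simp
    have hu0 : 0 < π.real {x | t < h x} := ENNReal.toReal_pos h0 (by simp)
    rw [hu] at hmeas ⊢
    set u := π.real {x | t < h x}
    rw [ENNReal.ofReal_le_ofReal_iff (by positivity)] at hmeas
    rw [← ENNReal.ofReal_mul (by positivity)]
    refine ENNReal.ofReal_le_ofReal ?_
    rw [mul_assoc, mul_comm (√_) u]
    gcongr
    rw [max_eq_left (by linarith)]
    have h2 : t ^ 2 ≤ u⁻¹ := by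
      rw [le_inv_comm₀ (by positivity) hu0, ← one_div]
      exact hmeas
    nlinarith [Real.exp_pos 1])
  set Y := ∫⁻ x, w (h x) ^ 2 ∂π with hY
  set P := ∫⁻ x, ENNReal.ofReal (h x / 2) * (w (h x / 2) * κ (h x / 2)) ∂π with hP
  have hwh : ∀ t, 0 ≤ t → w t ^ 2 = if L < t then ENNReal.ofReal (t ^ 2 * Real.log (max t 1))
      else 0 := by
    intro t ht
    simp only [hw]
    split_ifs
    · rw [← ENNReal.ofReal_pow (by positivity), mul_pow, Real.sq_sqrt (hl0 t)]
    · simp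
  -- Where `h > 2L`, also `h / 2 > L` and the halving lemma applies; where `L < h ≤ 2L`, the
  -- logarithm is bounded and `∫ h² ≤ 1`.
  have hYP : Y ≤ ENNReal.ofReal (8 / k) * P + ENNReal.ofReal (Real.log (2 * L)) := by
    calc Y ≤ ∫⁻ x, (ENNReal.ofReal (8 / k) * (ENNReal.ofReal (h x / 2) *
            (w (h x / 2) * κ (h x / 2))) +
            ENNReal.ofReal (Real.log (2 * L)) * ENNReal.ofReal (h x ^ 2)) ∂π := by
          refine lintegral_mono fun x => ?_
          simp only [hwh _ (hh0 x)]
          split_ifs with hx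
          · rcases lt_or_ge (2 * L) (h x) with h2 | h2
            · refine le_add_right ?_
              have h3 : L < h x / 2 := by linarith
              simp only [hw, hκ, if_pos h3]
              have h4 : 0 ≤ h x / 2 := by linarith
              rw [← ENNReal.ofReal_mul (by positivity), ← ENNReal.ofReal_mul (by positivity),
                ← ENNReal.ofReal_mul (by positivity)]
              refine ENNReal.ofReal_le_ofReal ?_
              rw [max_eq_left (by linarith), max_eq_left (by linarith)]
              have h5 : 0 ≤ Real.log (h x / 2) := Real.log_nonneg (by linarith)
              calc h x ^ 2 * Real.log (h x)
                  ≤ 8 * ((h x / 2) ^ 2 * Real.log (h x / 2)) :=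
                    sq_mul_log_le_of_four_le (by linarith)
                _ = 8 * ((h x / 2) ^ 2 * √(Real.log (h x / 2)) ^ 2) := by rw [Real.sq_sqrt h5]
                _ = _ := by field_simp
            · refine le_add_left ?_
              rw [← ENNReal.ofReal_mul hlog2L, mul_comm]
              refine ENNReal.ofReal_le_ofReal ?_
              gcongr
              exact max_le h2 (by linarith)
          · exact zero_le
      _ ≤ _ := by
          have := hwm.measurable
          have := hκm.measurable
          rw [lintegral_add_left (by fun_prop), lintegral_const_mul' _ _ ENNReal.ofReal_ne_top,
            lintegral_const_mul' _ _ ENNReal.ofReal_ne_top]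
          gcongr
          exact mul_le_of_le_one_right' h1
  -- Boundedness of `h` serves here: `Y / 2` will be absorbed, so `Y` must be finite.
  have hYt : Y ≠ ∞ := by
    refine ne_top_of_le_ne_top (b := w N ^ 2) ?_ ?_
    · simp only [hw]
      split_ifs <;> simp
    · refine (lintegral_mono fun x => pow_le_pow_left' (hwm (hN x)) 2).trans ?_
      simp
  have hfin : ∫⁻ x, ENNReal.ofReal (h x ^ 2 * Real.log (max (h x) 1)) ∂π ≤
      Y + ENNReal.ofReal (Real.log L) := by
    have := hwm.measurable
    calc _ ≤ ∫⁻ x, (w (h x) ^ 2 + ENNReal.ofReal (Real.log L) * ENNReal.ofReal (h x ^ 2)) ∂π := by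
          refine lintegral_mono fun x => ?_
          rw [hwh _ (hh0 x)]
          split_ifs with hx
          · exact le_add_right le_rfl
          · refine le_add_left ?_
            rw [← ENNReal.ofReal_mul hlogL, mul_comm]
            refine ENNReal.ofReal_le_ofReal ?_
            gcongr
            exact max_le (not_lt.1 hx) (by linarith)
      _ ≤ _ := by
          rw [lintegral_add_left (by fun_prop), lintegral_const_mul' _ _ ENNReal.ofReal_ne_top]
          gcongr
          exact mul_le_of_le_one_right' h1
  refine hfin.trans ?_
  rcases eq_or_ne (energy J h) ∞ with hD | hD
  · rw [hD, ENNReal.mul_top (by simp; positivity), top_add]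
    exact le_top
  have hPt : P ≠ ∞ := by
    intro hP
    rw [hP] at hmain
    have h' : 2 * energy J h * Y = ∞ := top_le_iff.1 (by simpa using hmain)
    exact absurd h' (ENNReal.mul_ne_top (ENNReal.mul_ne_top (by simp) hD) hYt)
  generalize energy J h = D at *
  clear_value Y P
  lift Y to ℝ≥0 using hYt
  lift P to ℝ≥0 using hPt
  lift D to ℝ≥0 using hD
  have e1 : (P : ℝ) ^ 2 ≤ 2 * D * Y := by
    have := ENNReal.toReal_mono (by finiteness) hmain
    simpa using this
  have e2 : (Y : ℝ) ≤ 8 / k * P + Real.log (2 * L) := by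
    have := ENNReal.toReal_mono (by finiteness) hYP
    rw [ENNReal.toReal_add (by finiteness) (by finiteness), ENNReal.toReal_mul,
      ENNReal.toReal_ofReal (by positivity), ENNReal.toReal_ofReal hlog2L] at this
    simpa using this
  -- The arithmetic-geometric mean inequality, weighted so that only half of `Y` appears.
  have e3 : 8 / k * (P : ℝ) ≤ Y / 2 + 64 * D / k ^ 2 := by
    refine abs_le_of_sq_le_sq' ?_ (by positivity) |>.2
    calc (8 / k * (P : ℝ)) ^ 2 = 64 / k ^ 2 * P ^ 2 := by ring
      _ ≤ 64 / k ^ 2 * (2 * D * Y) := by gcongr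
      _ = 4 * (Y / 2) * (64 * D / k ^ 2) := by ring
      _ ≤ _ := by nlinarith [sq_nonneg ((Y : ℝ) / 2 - 64 * D / k ^ 2)]
  rw [← ENNReal.ofReal_coe_nnreal, ← ENNReal.ofReal_coe_nnreal (p := D),
    ← ENNReal.ofReal_mul (by positivity), ← ENNReal.ofReal_add (by positivity) (by positivity),
    ← ENNReal.ofReal_add (by positivity) (by positivity)]
  refine ENNReal.ofReal_le_ofReal ?_
  have : 128 / k ^ 2 * (D : ℝ) = 2 * (64 * D / k ^ 2) := by ring
  linarith

/-- The defective inequality for normalized functions. -/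
theorem LogIsoperimetric.lintegral_sq_mul_log_le {s k L : ℝ}
    (hiso : LogIsoperimetric π (modified J r (1 / 2)) s k) (hk : 0 < k) (hL : 2 ≤ L)
    (hLs : 1 / L ^ 2 ≤ s) (hr : Measurable r) (hnorm : (modified J r 1).fst ≤ π)
    {h : E → ℝ} (hh : Measurable h) (hh0 : ∀ x, 0 ≤ h x)
    (h1 : ∫⁻ x, ENNReal.ofReal (h x ^ 2) ∂π ≤ 1) :
    ∫⁻ x, ENNReal.ofReal (h x ^ 2 * Real.log (max (h x) 1)) ∂π ≤
      ENNReal.ofReal (128 / k ^ 2) * energy J h +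
        ENNReal.ofReal (2 * Real.log (2 * L) + Real.log L) := by
  set F : ℝ → ℝ := fun t => t ^ 2 * Real.log (max t 1) with hF
  have hFm : Measurable F := by fun_prop
  have hmono : ∀ a b, 0 ≤ a → a ≤ b → F a ≤ F b := fun a b ha hab => by
    have : 0 ≤ Real.log (max a 1) := Real.log_nonneg (le_max_right _ _)
    simp only [hF]
    gcongr
  -- Truncations `min h n` are bounded and do not increase the energy; the constants do not depend
  -- on `n`.
  have hlim := lintegral_tendsto_of_tendsto_of_monotone (μ := π)
    (f := fun (n : ℕ) x => ENNReal.ofReal (F (min (h x) n)))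
    (F := fun x => ENNReal.ofReal (F (h x))) (fun n => by fun_prop)
    (ae_of_all _ fun x m n hmn => ENNReal.ofReal_le_ofReal
      (hmono _ _ (le_min (hh0 x) (by positivity)) (by gcongr)))
    (ae_of_all _ fun x => by
      refine tendsto_const_nhds.congr' ?_
      filter_upwards [eventually_ge_atTop ⌈h x⌉₊] with n hn
      rw [min_eq_left ((Nat.le_ceil _).trans (by exact_mod_cast hn))])
  refine le_of_tendsto' hlim fun n => ?_
  refine (hiso.lintegral_sq_mul_log_le_of_bounded hk hL hLs hr hnorm
    (h := fun x => min (h x) n) (by fun_prop) (fun x => le_min (hh0 x) (by positivity))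
    (N := n) (fun x => min_le_right _ _) ?_).trans ?_
  · refine (lintegral_mono fun x => ENNReal.ofReal_le_ofReal ?_).trans h1
    have := le_min (hh0 x) (Nat.cast_nonneg (α := ℝ) n)
    gcongr
    exact min_le_left _ _
  · gcongr
    exact energy_mono_of_forall J fun x y =>
      sq_le_sq.2 (by simpa using abs_min_sub_min_le_max (h y) (n : ℝ) (h x) n)

/-- The defective logarithmic inequality. -/
theorem LogIsoperimetric.exists_lintegral_sq_mul_log_le {s k : ℝ}
    (hiso : LogIsoperimetric π (modified J r (1 / 2)) s k) (hs : 0 < s) (hk : 0 < k)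
    (hr : Measurable r) (hnorm : (modified J r 1).fst ≤ π) :
    ∃ C : ℝ, 0 < C ∧ ∀ h : E → ℝ, Measurable h → (∀ x, 0 ≤ h x) → ∀ σ : ℝ, 0 < σ →
      ∫⁻ x, ENNReal.ofReal (h x ^ 2) ∂π ≤ ENNReal.ofReal (σ ^ 2) →
      ∫⁻ x, ENNReal.ofReal (h x ^ 2 * Real.log (max (h x / σ) 1)) ∂π ≤
        ENNReal.ofReal C * (energy J h + ENNReal.ofReal (σ ^ 2)) := by
  obtain ⟨L, hL, hLs⟩ : ∃ L : ℝ, 2 ≤ L ∧ 1 / L ^ 2 ≤ s := by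
    refine ⟨2 + 1 / s, by simp; positivity, ?_⟩
    rw [div_le_iff₀ (by positivity)]
    have : s * (2 + 1 / s) ^ 2 = 4 * s + 4 + 1 / s := by field_simp; ring
    have : 0 < 1 / s := by positivity
    linarith
  set C₂ := 2 * Real.log (2 * L) + Real.log L
  refine ⟨max (128 / k ^ 2) C₂, lt_max_of_lt_left (by positivity), fun h hh hh0 σ hσ hle => ?_⟩
  have hmain := hiso.lintegral_sq_mul_log_le hk hL hLs hr hnorm (h := fun x => h x / σ)
    (by fun_prop) (fun x => div_nonneg (hh0 x) hσ.le) (by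
      calc ∫⁻ x, ENNReal.ofReal ((h x / σ) ^ 2) ∂π
          = ENNReal.ofReal (1 / σ ^ 2) * ∫⁻ x, ENNReal.ofReal (h x ^ 2) ∂π := by
            rw [← lintegral_const_mul' _ _ ENNReal.ofReal_ne_top]
            refine lintegral_congr fun x => ?_
            rw [← ENNReal.ofReal_mul (by positivity)]
            congr 1
            ring
        _ ≤ ENNReal.ofReal (1 / σ ^ 2) * ENNReal.ofReal (σ ^ 2) := by gcongr
        _ = 1 := by
            rw [← ENNReal.ofReal_mul (by positivity), one_div_mul_cancel (by positivity),
              ENNReal.ofReal_one])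
  have hen : ENNReal.ofReal (σ ^ 2) * energy J (fun x => h x / σ) ≤ energy J h := by
    calc _ ≤ ENNReal.ofReal (σ ^ 2) * (ENNReal.ofReal (1 / σ ^ 2) * energy J h) := by
          gcongr
          refine energy_le_of_forall J (by positivity) fun x y => le_of_eq ?_
          ring
      _ = energy J h := by
          rw [← mul_assoc, ← ENNReal.ofReal_mul (by positivity),
            mul_one_div_cancel (by positivity), ENNReal.ofReal_one, one_mul]
  calc ∫⁻ x, ENNReal.ofReal (h x ^ 2 * Real.log (max (h x / σ) 1)) ∂π
      = ENNReal.ofReal (σ ^ 2) *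
          ∫⁻ x, ENNReal.ofReal ((h x / σ) ^ 2 * Real.log (max (h x / σ) 1)) ∂π := by
        rw [← lintegral_const_mul' _ _ ENNReal.ofReal_ne_top]
        refine lintegral_congr fun x => ?_
        rw [← ENNReal.ofReal_mul (by positivity)]
        congr 1
        field_simp
    _ ≤ ENNReal.ofReal (σ ^ 2) * (ENNReal.ofReal (128 / k ^ 2) *
          energy J (fun x => h x / σ) + ENNReal.ofReal C₂) := by gcongr
    _ = ENNReal.ofReal (128 / k ^ 2) * (ENNReal.ofReal (σ ^ 2) *
          energy J (fun x => h x / σ)) + ENNReal.ofReal C₂ * ENNReal.ofReal (σ ^ 2) := by ring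
    _ ≤ ENNReal.ofReal (max (128 / k ^ 2) C₂) * energy J h +
          ENNReal.ofReal (max (128 / k ^ 2) C₂) * ENNReal.ofReal (σ ^ 2) := by
        gcongr
        · exact le_max_left _ _
        · exact le_max_right _ _
    _ = _ := by ring

end Defective

/-- A pointwise bound for the entropy of a translate. -/
theorem sq_mul_log_sub_le (g c : ℝ) {σ : ℝ} (hσ : 0 < σ) :
    (g + c) ^ 2 * Real.log ((g + c) ^ 2 / max (c ^ 2) (σ ^ 2)) - (g + c) ^ 2 +
        max (c ^ 2) (σ ^ 2) ≤
      9 * g ^ 2 + 9 * σ ^ 2 + 8 * (g ^ 2 * Real.log (max (|g| / σ) 1)) := by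
  -- When `c` is the mean and `σ²` the variance, `b` is within a factor 2 of the second moment `c² +
  -- σ²`.
  set b := max (c ^ 2) (σ ^ 2) with hb
  have hσ2 : 0 < σ ^ 2 := by positivity
  have hbσ : σ ^ 2 ≤ b := le_max_right _ _
  have hbc : c ^ 2 ≤ b := le_max_left _ _
  have hb0 : 0 < b := hσ2.trans_le hbσ
  have hl : 0 ≤ g ^ 2 * Real.log (max (|g| / σ) 1) :=
    mul_nonneg (sq_nonneg _) (Real.log_nonneg (le_max_right _ _))
  have hfsq : 0 ≤ (g + c) ^ 2 := sq_nonneg _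
  rcases le_total (g ^ 2) b with hgb | hgb
  · have h1 : (g + c) ^ 2 * Real.log ((g + c) ^ 2 / b) ≤ (g + c) ^ 2 * ((g + c) ^ 2 / b - 1) := by
      rcases hfsq.eq_or_lt with h0 | h0
      · simp [← h0]
      · gcongr
        exact Real.log_le_sub_one_of_pos (by positivity)
    have h2 : (g + c) ^ 2 * ((g + c) ^ 2 / b - 1) - (g + c) ^ 2 + b = ((g + c) ^ 2 - b) ^ 2 / b := by
      field_simp
      ring
    have h3 : ((g + c) ^ 2 - b) ^ 2 / b ≤ 9 * g ^ 2 + 9 * σ ^ 2 := by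
      rw [div_le_iff₀ hb0]
      rcases le_total (σ ^ 2) (c ^ 2) with hcσ | hcσ
      · have hbe : b = c ^ 2 := max_eq_left hcσ
        rw [hbe] at hgb ⊢
        have h4 : (g + 2 * c) ^ 2 ≤ 9 * c ^ 2 := by nlinarith [sq_nonneg (g - c)]
        have h5 : ((g + c) ^ 2 - c ^ 2) ^ 2 = g ^ 2 * (g + 2 * c) ^ 2 := by ring
        rw [h5]
        nlinarith [mul_le_mul_of_nonneg_left h4 (sq_nonneg g), mul_nonneg hσ2.le (sq_nonneg c)]
      · have hbe : b = σ ^ 2 := max_eq_right hcσ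
        rw [hbe] at hgb ⊢
        have h4 : (g + c) ^ 2 ≤ 4 * σ ^ 2 := by nlinarith [sq_nonneg (g - c)]
        have h5 : ((g + c) ^ 2 - σ ^ 2) ^ 2 ≤ (3 * σ ^ 2) ^ 2 :=
          sq_le_sq' (by linarith) (by linarith)
        nlinarith [mul_nonneg hσ2.le (sq_nonneg g)]
    linarith
  · have h4 : (g + c) ^ 2 ≤ 4 * g ^ 2 := by nlinarith [sq_nonneg (g - c)]
    rcases le_total ((g + c) ^ 2) b with hfb | hfb
    · have h1 : Real.log ((g + c) ^ 2 / b) ≤ 0 :=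
        Real.log_nonpos (by positivity) ((div_le_one hb0).2 hfb)
      have := mul_nonpos_of_nonneg_of_nonpos hfsq h1
      nlinarith
    · have hg0 : 0 < |g| := by
        have : 0 < g ^ 2 := hb0.trans_le hgb
        exact abs_pos.2 (by rintro rfl; simp at this)
      have hgσ : 1 ≤ |g| / σ := by
        rw [one_le_div hσ, ← abs_of_pos hσ]
        exact sq_le_sq.1 (hbσ.trans hgb)
      rw [max_eq_left hgσ] at hl ⊢
      have h1 : Real.log ((g + c) ^ 2 / b) ≤ 2 + 2 * Real.log (|g| / σ) := by
        calc Real.log ((g + c) ^ 2 / b) ≤ Real.log ((2 * (|g| / σ)) ^ 2) := by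
              refine Real.log_le_log (by have := hb0.trans_le hfb; positivity) ?_
              rw [mul_pow, div_pow, sq_abs, mul_div_assoc', show (2 : ℝ) ^ 2 = 4 by norm_num]
              gcongr
          _ = 2 * Real.log 2 + 2 * Real.log (|g| / σ) := by
              rw [Real.log_pow, Real.log_mul (by norm_num) (by positivity)]
              push_cast
              ring
          _ ≤ _ := by linarith [Real.log_two_lt_d9]
      have h0 : 0 ≤ 2 + 2 * Real.log (|g| / σ) := by
        have := Real.log_nonneg hgσ
        linarith
      have h2 : (g + c) ^ 2 * Real.log ((g + c) ^ 2 / b) ≤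
          4 * g ^ 2 * (2 + 2 * Real.log (|g| / σ)) :=
        mul_le_mul h4 h1 (Real.log_nonneg ((one_le_div hb0).2 hfb)) (by positivity)
      nlinarith

/-- The entropy is finite and bounded by the integral of a pointwise bound at any level. -/
theorem integrable_entropy_and_le {π : Measure E} [IsProbabilityMeasure π] {f Z : E → ℝ}
    (hf : Measurable f) (hf2 : Integrable (fun x => f x ^ 2) π) (hpos : 0 < ∫ x, f x ^ 2 ∂π)
    (hZ : Integrable Z π) {b : ℝ} (hb : 0 < b)
    (H : ∀ x, f x ^ 2 * Real.log (f x ^ 2 / b) - f x ^ 2 + b ≤ Z x) :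
    Integrable (fun x => f x ^ 2 * Real.log (f x ^ 2 / ∫ y, f y ^ 2 ∂π)) π ∧
      ∫ x, f x ^ 2 * Real.log (f x ^ 2 / ∫ y, f y ^ 2 ∂π) ∂π ≤ ∫ x, Z x ∂π := by
  set a := ∫ x, f x ^ 2 ∂π
  -- Nonnegativity turns the upper bound by `Z` into integrability.
  have hlow : ∀ x, 0 ≤ f x ^ 2 * Real.log (f x ^ 2 / b) - f x ^ 2 + b := by
    intro x
    rcases (sq_nonneg (f x)).eq_or_lt with h0 | h0
    · simp [← h0, hb.le]
    · have h1 := Real.one_sub_inv_le_log_of_pos (div_pos h0 hb)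
      have h2 : f x ^ 2 * (1 - (f x ^ 2 / b)⁻¹) = f x ^ 2 - b := by
        rw [inv_div, mul_sub, mul_one, mul_div_cancel₀ _ h0.ne']
      nlinarith [mul_le_mul_of_nonneg_left h1 h0.le]
  have hW : Integrable (fun x => f x ^ 2 * Real.log (f x ^ 2 / b) - f x ^ 2 + b) π := by
    refine hZ.mono (by fun_prop) (ae_of_all _ fun x => ?_)
    rw [Real.norm_eq_abs, Real.norm_eq_abs, abs_of_nonneg (hlow x)]
    exact (H x).trans (le_abs_self _)
  -- The remainder integrates to `a log(b/a) + a - b ≤ 0`: the level `b = a` is optimal, so any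
  -- other only increases the bound.
  have e : ∀ x, f x ^ 2 * Real.log (f x ^ 2 / a) =
      (f x ^ 2 * Real.log (f x ^ 2 / b) - f x ^ 2 + b) +
        ((1 + Real.log (b / a)) * f x ^ 2 - b) := by
    intro x
    rcases eq_or_ne (f x ^ 2) 0 with h0 | h0
    · simp [h0]
    · rw [Real.log_div h0 hpos.ne', Real.log_div h0 hb.ne', Real.log_div hb.ne' hpos.ne']
      ring
  simp_rw [e]
  have hV : Integrable (fun x => (1 + Real.log (b / a)) * f x ^ 2 - b) π :=
    (hf2.const_mul (1 + Real.log (b / a))).sub (integrable_const b)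
  refine ⟨hW.add hV, ?_⟩
  rw [integral_add hW hV, integral_sub (hf2.const_mul _) (integrable_const _),
    integral_const_mul]
  simp only [integral_const, probReal_univ, one_smul]
  have h1 := integral_mono hW hZ H
  have h2 := Real.log_le_sub_one_of_pos (div_pos hb hpos)
  have h3 : a * Real.log (b / a) ≤ b - a := by
    calc a * Real.log (b / a) ≤ a * (b / a - 1) := by gcongr
      _ = b - a := by field_simp
  change _ + ((1 + Real.log (b / a)) * a - b) ≤ _
  linarith

/-! ### Removal of the defect by the Poincaré inequality -/

section LogSobolev

variable {π : Measure E} [IsProbabilityMeasure π] {J : Measure (E × E)} {r : E × E → ℝ≥0}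

/-- With `m` the mean and `σ²` the variance, the pointwise bound and the defective inequality for
`|f - m|` bound the entropy by `18 σ² + 8 C (D(f) + σ²)`; Poincaré gives `σ² ≤ C' D(f)`. -/
theorem LogIsoperimetric.logSobolevInequality {s k : ℝ}
    (hiso : LogIsoperimetric π (modified J r (1 / 2)) s k) (hs : 0 < s) (hk : 0 < k)
    (hirr : Irreducible π J) (hr : Measurable r) (hnorm : (modified J r 1).fst ≤ π) :
    LogSobolevInequality π J := by
  obtain ⟨C, hC, HC⟩ := hiso.exists_lintegral_sq_mul_log_le hs hk hr hnorm
  obtain ⟨C', hC', HC'⟩ := hirr.poincareInequality hs (C := 32 / k ^ 2) (by positivity)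
    fun g hg hg0 hg2 hsupp => hiso.lintegral_sq_le hk hr hnorm hg hg0 hg2 hsupp
  refine ⟨18 * C' + 8 * (C * (1 + C')), by positivity, fun f hf hf2 hD => ?_⟩
  have hP := HC' f hf hf2
  set m := ∫ x, f x ∂π with hm
  have hvar : variance f π = ∫ x, (f x - m) ^ 2 ∂π := variance_eq_integral hf.aemeasurable
  have hvar0 : 0 ≤ variance f π := variance_nonneg _ _
  have hgi : Integrable (fun x => (f x - m) ^ 2) π := (hf2.sub (memLp_const m)).integrable_sq
  rcases hvar0.eq_or_lt with h0 | h0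
  -- Zero variance is treated apart, since `σ` occurs as a denominator; `f` is then constant and its
  -- entropy vanishes.
  · have hae : ∀ᵐ x ∂π, f x = m := by
      rw [h0.symm] at hvar
      have := (integral_eq_zero_iff_of_nonneg (fun x => sq_nonneg _) hgi).1 hvar.symm
      filter_upwards [this] with x hx
      have : f x - m = 0 := by simpa using hx
      linarith
    have hsq : ∫ y, f y ^ 2 ∂π = m ^ 2 := by
      rw [integral_congr_ae (g := fun _ => m ^ 2) (by filter_upwards [hae] with x hx; rw [hx])]
      simp
    have hz : (fun x => f x ^ 2 * Real.log (f x ^ 2 / ∫ y, f y ^ 2 ∂π)) =ᵐ[π] fun _ => 0 := by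
      filter_upwards [hae] with x hx
      rw [hsq, hx]
      rcases eq_or_ne (m ^ 2) 0 with h | h
      · simp [h]
      · simp [div_self h]
    refine ⟨(integrable_congr hz).2 (integrable_const 0), ?_⟩
    rw [integral_congr_ae hz]
    simp only [integral_const, smul_zero]
    positivity
  set σ := √(variance f π) with hσdef
  have hσ : 0 < σ := Real.sqrt_pos.2 h0
  have hσ2 : σ ^ 2 = variance f π := Real.sq_sqrt hvar0
  have hpos : 0 < ∫ x, f x ^ 2 ∂π := h0.trans_le (variance_le_expectation_sq hf.aestronglyMeasurable)
  have hPreal : σ ^ 2 ≤ C' * (energy J f).toReal := by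
    have := ENNReal.toReal_mono (by finiteness) hP
    rwa [ENNReal.toReal_ofReal hvar0, ENNReal.toReal_mul, ENNReal.toReal_ofReal hC'.le,
      ← hσ2] at this
  have hlog := HC (fun x => |f x - m|) (by fun_prop) (fun x => abs_nonneg _) σ hσ (by
    simp_rw [sq_abs]
    rw [← ofReal_integral_eq_lintegral_ofReal hgi (ae_of_all _ fun x => sq_nonneg _), ← hvar, hσ2])
  have hen : energy J (fun x => |f x - m|) ≤ energy J f :=
    energy_mono_of_forall J fun x y => sq_le_sq.2 (by
      simpa using abs_abs_sub_abs_le_abs_sub (f y - m) (f x - m))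
  have hlog := hlog.trans (mul_le_mul_right (add_le_add_left hen _) _)
  simp_rw [sq_abs] at hlog
  have hl0 : ∀ x, 0 ≤ (f x - m) ^ 2 * Real.log (max (|f x - m| / σ) 1) := fun x =>
    mul_nonneg (sq_nonneg _) (Real.log_nonneg (le_max_right _ _))
  have hli : Integrable (fun x => (f x - m) ^ 2 * Real.log (max (|f x - m| / σ) 1)) π := by
    refine (lintegral_ofReal_ne_top_iff_integrable (by fun_prop) (ae_of_all _ hl0)).1 ?_
    exact ne_top_of_le_ne_top (by finiteness) hlog
  have hlreal : ∫ x, (f x - m) ^ 2 * Real.log (max (|f x - m| / σ) 1) ∂π ≤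
      C * ((energy J f).toReal + σ ^ 2) := by
    rw [integral_eq_lintegral_of_nonneg_ae (ae_of_all _ hl0) (by fun_prop)]
    refine (ENNReal.toReal_mono (by finiteness) hlog).trans (le_of_eq ?_)
    rw [ENNReal.toReal_mul, ENNReal.toReal_add hD.ne (by finiteness),
      ENNReal.toReal_ofReal hC.le, ENNReal.toReal_ofReal (by positivity)]
  have hgc : Integrable (fun x => 9 * (f x - m) ^ 2 + 9 * σ ^ 2) π :=
    (hgi.const_mul 9).add (integrable_const _)
  have hZi : Integrable (fun x => 9 * (f x - m) ^ 2 + 9 * σ ^ 2 +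
      8 * ((f x - m) ^ 2 * Real.log (max (|f x - m| / σ) 1))) π :=
    hgc.add (hli.const_mul 8)
  obtain ⟨hint, hle⟩ := integrable_entropy_and_le hf hf2.integrable_sq hpos hZi
    (b := max (m ^ 2) (σ ^ 2)) (lt_max_of_lt_right (by positivity))
    fun x => by simpa using sq_mul_log_sub_le (f x - m) m hσ
  refine ⟨hint, hle.trans ?_⟩
  rw [integral_add hgc (hli.const_mul 8),
    integral_add (hgi.const_mul 9) (integrable_const _), integral_const_mul,
    ← hvar, ← hσ2]
  simp only [integral_const, integral_const_mul, probReal_univ, one_smul]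
  have : C * ((energy J f).toReal + σ ^ 2) ≤ C * (1 + C') * (energy J f).toReal := by
    rw [mul_assoc]
    gcongr
    linarith
  linarith

end LogSobolev

end JumpForm

theorem mainTheorem3 {E : Type*} [MeasurableSpace E]
    (hdiag : MeasurableSet (Set.diagonal E))
    (π : Measure E) [IsProbabilityMeasure π]
    (J : Measure (E × E))
    (hJsymm : J.map Prod.swap = J)
    (hJdiag : J (Set.diagonal E) = 0)
    (r : E × E → ℝ≥0) (hr : Measurable r)
    (hrsymm : ∀ x y, r (x, y) = r (y, x))
    (hnorm : (JumpForm.modified J r 1).fst ≤ π) :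
    (0 < JumpForm.poincareConst π (JumpForm.modified J r (1 / 2)) →
      JumpForm.PoincareInequality π J) ∧
    (∀ p q : ℝ, p.HolderConjugate q →
      0 < JumpForm.nashConst π (JumpForm.modified J r (1 / 2)) (2 * (q - 1)) →
      JumpForm.NashInequality π J p q) ∧
    (JumpForm.Irreducible π J →
      0 < JumpForm.logSobolevConstSmall π (JumpForm.modified J r (1 / 2)) →
      JumpForm.LogSobolevInequality π J) ∧
    (JumpForm.Irreducible π J →
      0 < JumpForm.logSobolevConstShift π (JumpForm.modified J r (1 / 2)) →
      JumpForm.LogSobolevInequality π J) := by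
  refine ⟨JumpForm.poincareInequality_of_poincareConst_pos hr hnorm,
    fun p q hpq => JumpForm.nashInequality_of_nashConst_pos hr hnorm hpq,
    fun hirr h => ?_, fun hirr h => ?_⟩
  · obtain ⟨s, k, hs, hk, hiso⟩ := JumpForm.exists_logIsoperimetric_of_constSmall_pos h
    exact hiso.logSobolevInequality hs hk hirr hr hnorm
  · obtain ⟨s, k, hs, hk, hiso⟩ := JumpForm.exists_logIsoperimetric_of_constShift_pos h
    exact hiso.logSobolevInequality hs hk hirr hr hnorm
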